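/- **Theorem (Regret of OLS-th).** Let $p\ge 2$, let $\Sigma$ be a $p\times p$ covariance matrix, $\sigma>0$, and consider a stream of observations $y_i=\mathbf x_i^T\beta^*+\epsilon_i$, $i=1,2,\dots$, where the pairs $(\mathbf x_i,\epsilon_i)$ are i.i.d., $\mathbf x_i\sim\mathcal N(0,\Sigma)$ and $\epsilon_i\sim\mathcal N(0,\sigma^2)$ are independent. Let $S^*=\{j:\beta^*_j\neq 0\}$ and $k=|S^*|$. For a horizon $n>p$ put $$n_0=\max\Big(p+1,\ 400\log n,\ \tfrac14\Big(\tfrac{2\log n}{\log p}+1\Big)^2\Big).$$ *Algorithm (OLS-th).* For $i=1,\dots,n$ the vector $\beta_i$ is computed from the observations $1,\dots,i-1$ as follows: fit least squares on all features; keep $k$ features with the largest absolute coefficients (ties are broken by any measurable rule depending only on these observations); refit least squares on the kept features, all other coefficients being $0$. For the first steps $i\le n_0$ both least squares fits are ridge regressions with a fixed parameter $r>0$, i.e. solutions of $\sum_{t<i}\mathbf x_t\mathbf x_t^T\beta+r\beta=\sum_{t<i}y_t\mathbf x_t$ (on the features used); for $i>n_0$ they are ordinary least squares fits ($r=0$).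 *Assumptions on the columns in $S^*$* (with constants $m,M,D,G$). Write $\mathbf x_{i,S^*}$ for the restriction of $\mathbf x_i$ to $S^*$. (A1) $0<m<M$, and for all $p<i\le n$ all eigenvalues of $\frac1i\sum_{t\le i}\mathbf x_{t,S^*}\mathbf x_{t,S^*}^T$ lie in $(m,M)$. (A2) The ordinary least squares iterates $\bar\beta_i$ ($p<i\le n+1$) on the features in $S^*$, where $\bar\beta_i$ is computed from the observations $1,\dots,i-1$, satisfy $\|\bar\beta_i-\bar\beta_j\|<D$ for all $p<i,j\le n+1$ and $\|\nabla f_i(\bar\beta_i)\|\le G$ for all $p<i\le n$, where $f_i(\beta)=(y_i-\mathbf x_{i,S^*}^T\beta)^2$. *Claim.* For every $B$ there is a constant $C_1>0$, depending only on $p,\Sigma,\sigma,r,B$, such that for every $\beta^*$ with $\|\beta^*\|\le B$, every $n>p$ and all $m,M,D,G$: if $$\min_{j\in S^*}|\beta^*_j|>\frac{4\sigma}{\lambda}\sqrt{\frac{\log p}{\sqrt n}}\quad\text{for some }\lambda>0\text{ such that }\sqrt\lambda<0.9\,\lambda_{\min}(\sqrt\Sigma)-\sqrt{\frac p{n_0}},$$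 then with probability at least $1-3/n$ the following holds: if the data satisfy (A1) and (A2), then the regret of OLS-th satisfies $$R_n=\frac1n\sum_{i=1}^n(y_i-\mathbf x_i^T\beta_i)^2-\min_{\|\beta\|_0\le k}\frac1n\sum_{i=1}^n(y_i-\mathbf x_i^T\beta)^2\ \le\ C_1\Big(1+\frac{G^2}{m}+MD^2\Big)\frac{\log^2 n}{n}.$$ In particular $R_n=O(\log^2 n/n)$ for fixed $m,M,D,G$. -/

import Mathlib

open MeasureTheory ProbabilityTheory
open scoped RealInnerProductSpace MatrixOrder Gradient

noncomputable section

namespace OLSth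

/-- Observations are indexed by `i = 1, 2, …`; a data stream is a pair of sequences
`x : ℕ → EuclideanSpace ℝ ι`, `y : ℕ → ℝ` (the terms of index `0` are never used). -/
abbrev Vec (ι : Type*) := EuclideanSpace ℝ ι

/-- The squared loss `f(b; (x, y)) = (y - xᵀ b)²`. -/
def sqLoss {ι : Type*} [Fintype ι] (b x : Vec ι) (y : ℝ) : ℝ := (y - ⟪x, b⟫) ^ 2

/-- `b` solves the (ridge) least squares equations built from the observations with index
`1, …, i - 1`, i.e. `∑_{t<i} x_t x_tᵀ b + r b = ∑_{t<i} y_t x_t`.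
For `r = 0` this is ordinary least squares (OLS). -/
def IsLSFit {ι : Type*} [Fintype ι] (x : ℕ → Vec ι) (y : ℕ → ℝ) (r : ℝ) (i : ℕ)
    (b : Vec ι) : Prop :=
  (∑ t ∈ Finset.Ico 1 i, ⟪x t, b⟫ • x t) + r • b = ∑ t ∈ Finset.Ico 1 i, y t • x t

/-- The restriction of a vector to the coordinates in `S`. -/
def restrictTo {p : ℕ} (S : Finset (Fin p)) (v : Vec (Fin p)) : Vec S :=
  WithLp.toLp 2 (fun j : S => v j)

/-- `S` is an index set of the `k` largest values of `|b_j|` (ties broken in any way). -/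
def IsTop {p : ℕ} (k : ℕ) (b : Vec (Fin p)) (S : Finset (Fin p)) : Prop :=
  S.card = k ∧ ∀ j ∈ S, ∀ l ∉ S, |b l| ≤ |b j|

/-- `b` is an output of least squares with thresholding, run with sparsity level `k` and ridge
parameter `r` on the observations `1, …, i - 1`: fit all the features, keep the `k` features with
the largest coefficients in absolute value, refit on these features only. -/
def IsLSthFit {p : ℕ} (x : ℕ → Vec (Fin p)) (y : ℕ → ℝ) (r : ℝ) (k i : ℕ)
    (b : Vec (Fin p)) : Prop :=
  ∃ (b₀ : Vec (Fin p)) (S : Finset (Fin p)),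
    IsLSFit x y r i b₀ ∧ IsTop k b₀ S ∧
    IsLSFit (fun t => restrictTo S (x t)) y r i (restrictTo S b) ∧ ∀ j ∉ S, b j = 0

/-- `n₀ = max (p + 1, 400 log n, ¼ (2 log n / log p + 1)²)`. -/
def nZero (p n : ℕ) : ℝ :=
  max ((p : ℝ) + 1)
    (max (400 * Real.log n) (1 / 4 * (2 * Real.log n / Real.log p + 1) ^ 2))

/-- `b 1, …, b n` are the coefficient vectors of online OLS-th over the horizon `n`: `b i` is
computed from the observations `1, …, i - 1`, with ridge regression (parameter `r`) in place of
least squares for the first `n₀` steps and with ordinary least squares afterwards. -/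
def IsOLSthRun {p : ℕ} (x : ℕ → Vec (Fin p)) (y : ℕ → ℝ) (r : ℝ) (k n : ℕ)
    (b : ℕ → Vec (Fin p)) : Prop :=
  ∀ i, 1 ≤ i → i ≤ n →
    ((i : ℝ) ≤ nZero p n → IsLSthFit x y r k i (b i)) ∧
    (nZero p n < (i : ℝ) → IsLSthFit x y 0 k i (b i))

/-- The index set of the nonzero coordinates. -/
def supp {p : ℕ} (b : Vec (Fin p)) : Finset (Fin p) := {j | b j ≠ 0}

/-- The regret of `b 1, …, b n` against the best fixed vector with at most `k` nonzero
coordinates. -/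
def regret {p : ℕ} (x : ℕ → Vec (Fin p)) (y : ℕ → ℝ) (k n : ℕ) (b : ℕ → Vec (Fin p)) : ℝ :=
  1 / (n : ℝ) * ∑ i ∈ Finset.Icc 1 n, sqLoss (b i) (x i) (y i) -
    ⨅ c : {c : Vec (Fin p) // (supp c).card ≤ k},
      1 / (n : ℝ) * ∑ i ∈ Finset.Icc 1 n, sqLoss c.1 (x i) (y i)

/-- Smallest eigenvalue of a symmetric matrix. -/
def lamMin {ι : Type*} [Fintype ι] [DecidableEq ι] (A : Matrix ι ι ℝ) : ℝ := sInf (spectrum ℝ A)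

/-- Largest eigenvalue of a symmetric matrix. -/
def lamMax {ι : Type*} [Fintype ι] [DecidableEq ι] (A : Matrix ι ι ℝ) : ℝ := sSup (spectrum ℝ A)

/-- `(1/i) ∑_{t ≤ i} x_t x_tᵀ`. -/
def gram {ι : Type*} [Fintype ι] (x : ℕ → Vec ι) (i : ℕ) : Matrix ι ι ℝ :=
  (1 / (i : ℝ)) • ∑ t ∈ Finset.Icc 1 i, Matrix.vecMulVec (x t) (x t)

/-- The eigenvalues of the matrices `(1/i) (XᵀX)_i` lie in `(m, M)` for all sample sizes `i > p`
up to the horizon `n`. -/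
def EigBounds {ι : Type*} [Fintype ι] [DecidableEq ι] (x : ℕ → Vec ι) (p n : ℕ) (m M : ℝ) :
    Prop :=
  0 < m ∧ m < M ∧ ∀ i, p < i → i ≤ n → m < lamMin (gram x i) ∧ lamMax (gram x i) < M

/-- The OLS iterates with index `> p` (up to the last one computable from `n` observations) are
within distance `D` of each other, and the loss gradients at them are bounded by `G`. -/
def IterateBounds {ι : Type*} [Fintype ι] (x : ℕ → Vec ι) (y : ℕ → ℝ) (p n : ℕ) (D G : ℝ) :
    Prop :=
  ∃ b : ℕ → Vec ι,
    (∀ i, p < i → i ≤ n + 1 → IsLSFit x y 0 i (b i)) ∧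
    (∀ i j, p < i → i ≤ n + 1 → p < j → j ≤ n + 1 → ‖b i - b j‖ < D) ∧
    ∀ i, p < i → i ≤ n → ‖∇ (fun v => sqLoss v (x i) (y i)) (b i)‖ ≤ G

/-- The lower bound on the nonzero coefficients. -/
def BetaMin {p : ℕ} (Sig : Matrix (Fin p) (Fin p) ℝ) (σ : ℝ) (βs : Vec (Fin p)) (n : ℕ) :
    Prop :=
  ∃ lam : ℝ, 0 < lam ∧
    √lam < 0.9 * lamMin (CFC.sqrt Sig) - √((p : ℝ) / nZero p n) ∧
    ∀ j ∈ supp βs, 4 * σ / lam * √(Real.log p / √(n : ℝ)) < |βs j|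

/-- The pairs `(x_i, ε_i)` are i.i.d., where `x_i ∼ N(0, Sig)` and `ε_i ∼ N(0, σ²)` are
independent. -/
structure IsGaussianStream {p : ℕ} {Ω : Type*} [MeasurableSpace Ω] (P : Measure Ω)
    (Sig : Matrix (Fin p) (Fin p) ℝ) (σ : ℝ) (x : ℕ → Ω → Vec (Fin p)) (ε : ℕ → Ω → ℝ) :
    Prop where
  measurable_x : ∀ i, Measurable (x i)
  measurable_eps : ∀ i, Measurable (ε i)
  law : ∀ i, P.map (fun ω => (x i ω, ε i ω)) =
    (multivariateGaussian 0 Sig).prod (gaussianReal 0 (σ ^ 2).toNNReal)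
  indep : iIndepFun (fun i ω => (x i ω, ε i ω)) P

/-- The responses `y_i = x_iᵀ βs + ε_i` of the linear model. -/
def response {p : ℕ} {Ω : Type*} (x : ℕ → Ω → Vec (Fin p)) (ε : ℕ → Ω → ℝ) (βs : Vec (Fin p))
    (i : ℕ) (ω : Ω) : ℝ := ⟪x i ω, βs⟫ + ε i ω

/-- `b i` is a measurable function of the observations `1, …, i - 1`. -/
def IsOnline {p : ℕ} {Ω : Type*} (x : ℕ → Ω → Vec (Fin p)) (y : ℕ → Ω → ℝ)
    (b : ℕ → Ω → Vec (Fin p)) (n : ℕ) : Prop :=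
  ∀ i, 1 ≤ i → i ≤ n →
    Measurable[⨆ t ∈ Finset.Ico 1 i,
      MeasurableSpace.comap (fun ω => (x t ω, y t ω)) inferInstance] (b i)

end OLSth

end

/-! Write L = log n and let β be the true vector. Expanding the squares, the cumulative loss is
∑ε_i² + 2∑ε_i⟪x_i, β - b_i⟫ + ∑⟪x_i, β - b_i⟫². Three estimates, valid off an event of probability
at most 3/n, bound its excess over any fixed comparator by O(L²).

Comparator: completing the square with ‖∑ε_t x_t‖ = O(√(nL)) and λ_min(∑x_t x_tᵀ) ≥ cn shows that no
fixed vector beats β by more than O(L) in total loss (`IsRegular.sum_sqLoss_ge`).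

Noise: b_i depends only on the past, so the linear term is a martingale transform; the Gaussian
exponential martingale bounds it by half the quadratic term plus O(L)
(`IsGaussianStream.measure_sum_ge_le`).

Estimation error: exact support recovery is not needed. A nonzero coefficient dropped by
thresholding is at most twice the error of the full fit, so the refit has an error of the same order
(`IsLSthFit.norm_sub_le`). Hence ‖b_i - β‖² = O(L/i) once i - 1 ≥ max(p, L), and the quadratic term
sums to O(L ∑‖x_i‖²/i) = O(L²). In the O(L) steps before that, the ridge penalty alone gives ‖b_i -
β‖² = O(L), again O(L²) in total.

The eigenvalue bound comes from a small-ball argument on blocks of p samples, which needs Σ positive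
definite; the condition on λ forces this. -/

namespace OLSth

/-! ### Chernoff bound for weighted sums. -/

section Chernoff

variable {Ω : Type*} [MeasurableSpace Ω] {P : Measure Ω}

/-- Convexity of exp on the segment from 0 to z. It makes the weight enter an exponential moment
linearly, so sums weighted by 1/t are bounded in terms of ∑ 1/t. -/
lemma exp_mul_le_one_add_mul {w z : ℝ} (hw0 : 0 ≤ w) (hw1 : w ≤ 1) :
    Real.exp (w * z) ≤ 1 + w * (Real.exp z - 1) := by
  have h := convexOn_exp.2 (Set.mem_univ z) (Set.mem_univ 0) hw0 (sub_nonneg.2 hw1) (by ring)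
  simp only [smul_eq_mul, mul_zero, add_zero, Real.exp_zero, mul_one] at h
  linarith

/-- A Chernoff bound for weighted sums of independent nonnegative variables. -/
lemma measure_weighted_sum_ge_le [IsProbabilityMeasure P] {Z : ℕ → Ω → ℝ} (hind : iIndepFun Z P)
    (hm : ∀ i, Measurable (Z i)) (hZ : ∀ i ω, 0 ≤ Z i ω) {s K : ℝ} (hs : 0 < s)
    (hint : ∀ i, Integrable (fun ω => Real.exp (s * Z i ω)) P)
    (hK : ∀ i, mgf (Z i) P s ≤ 1 + K) (I : Finset ℕ) {w : ℕ → ℝ}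
    (hw : ∀ i, 0 ≤ w i ∧ w i ≤ 1) (u : ℝ) :
    P {ω | (K * ∑ i ∈ I, w i + u) / s ≤ ∑ i ∈ I, w i * Z i ω} ≤
      ENNReal.ofReal (Real.exp (-u)) := by
  let Y : ℕ → Ω → ℝ := fun i ω => w i * Z i ω
  have hY : iIndepFun Y P := hind.comp (fun i z => w i * z) (fun i => by fun_prop)
  have hYm : ∀ i, Measurable (Y i) := fun i => (hm i).const_mul _
  have hYint : ∀ i, Integrable (fun ω => Real.exp (s * Y i ω)) P := fun i => by
    refine (hint i).mono' (by fun_prop) (ae_of_all _ fun ω => ?_)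
    rw [Real.norm_eq_abs, abs_of_pos (Real.exp_pos _)]
    refine Real.exp_le_exp.2 (mul_le_mul_of_nonneg_left ?_ hs.le)
    exact mul_le_of_le_one_left (hZ i ω) (hw i).2
  have hmgf : ∀ i, mgf (Y i) P s ≤ Real.exp (K * w i) := fun i => by
    have h1 : mgf (Y i) P s ≤ ∫ ω, (1 + w i * (Real.exp (s * Z i ω) - 1)) ∂P := by
      refine integral_mono (hYint i) ?_ fun ω => ?_
      · exact (integrable_const _).add (((hint i).sub (integrable_const _)).const_mul _)
      · have := exp_mul_le_one_add_mul (z := s * Z i ω) (hw i).1 (hw i).2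
        calc Real.exp (s * Y i ω) = Real.exp (w i * (s * Z i ω)) := by
              congr 1; simp only [Y]; ring
          _ ≤ _ := this
    have h2 : ∫ ω, (1 + w i * (Real.exp (s * Z i ω) - 1)) ∂P = 1 + w i * (mgf (Z i) P s - 1) := by
      have hi : Integrable (fun ω => Real.exp (s * Z i ω) - 1) P :=
        (hint i).sub (integrable_const _)
      rw [integral_add (integrable_const _) (hi.const_mul _),
        integral_const_mul, integral_sub (hint i) (integrable_const _)]
      simp [mgf]
    rw [h2] at h1
    have h3 : w i * (mgf (Z i) P s - 1) ≤ w i * K :=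
      mul_le_mul_of_nonneg_left (by linarith [hK i]) (hw i).1
    linarith [Real.add_one_le_exp (K * w i)]
  have hsum := hY.integrable_exp_mul_sum (t := s) hYm (s := I) fun i _ => hYint i
  have hC := measure_ge_le_exp_mul_mgf (μ := P) (X := ∑ i ∈ I, Y i)
    ((K * ∑ i ∈ I, w i + u) / s) hs.le hsum
  rw [hY.mgf_sum hYm] at hC
  have hprod : ∏ i ∈ I, mgf (Y i) P s ≤ Real.exp (K * ∑ i ∈ I, w i) := by
    rw [Finset.mul_sum, Real.exp_sum]
    exact Finset.prod_le_prod (fun i _ => mgf_nonneg) fun i _ => hmgf i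
  have hfin : P.real {ω | (K * ∑ i ∈ I, w i + u) / s ≤ (∑ i ∈ I, Y i) ω} ≤ Real.exp (-u) := by
    refine hC.trans ((mul_le_mul_of_nonneg_left hprod (Real.exp_pos _).le).trans ?_)
    rw [← Real.exp_add]
    refine Real.exp_le_exp.2 (le_of_eq ?_)
    field_simp
    ring
  simp only [Finset.sum_apply] at hfin
  rw [← ofReal_measureReal (μ := P)]
  exact ENNReal.ofReal_le_ofReal hfin

end Chernoff

/-! ### Exponential martingale for predictable Gaussian noise. -/

section ExpMartingale

variable {Ω : Type*} [mΩ : MeasurableSpace Ω] {P : Measure Ω}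

lemma lintegral_comp_eq_of_indepFun {E E' : Type*} [MeasurableSpace E] [MeasurableSpace E']
    [IsProbabilityMeasure P] {Y : Ω → E'} {Z : Ω → E} (hY : Measurable Y) (hZ : Measurable Z)
    (hind : IndepFun Y Z P) {F : E' × E → ENNReal} (hF : Measurable F) :
    ∫⁻ ω, F (Y ω, Z ω) ∂P = ∫⁻ ω, ∫⁻ z, F (Y ω, z) ∂(P.map Z) ∂P := by
  have h := (indepFun_iff_map_prod_eq_prod_map_map hY.aemeasurable hZ.aemeasurable).1 hind
  have : IsProbabilityMeasure (P.map Z) := Measure.isProbabilityMeasure_map hZ.aemeasurable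
  have : IsProbabilityMeasure (P.map Y) := Measure.isProbabilityMeasure_map hY.aemeasurable
  rw [← lintegral_map hF (hY.prodMk hZ), h, lintegral_prod _ hF.aemeasurable,
    lintegral_map hF.lintegral_prod_right' hY]

/-- Freezing: Z can be integrated out first while everything known to `m` is held fixed. This is the
product-law statement with Y the identity, seen as a map from Ω to Ω carrying the smaller σ-algebra
`m`. -/
lemma lintegral_comp_eq_of_indep {E : Type*} [mE : MeasurableSpace E] [IsProbabilityMeasure P]
    (m : MeasurableSpace Ω) (hm : m ≤ mΩ) {Z : Ω → E} (hZ : @Measurable _ _ mΩ _ Z)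
    (hind : @Indep Ω m (MeasurableSpace.comap Z mE) mΩ P) {F : Ω × E → ENNReal}
    (hF : @Measurable (Ω × E) _ (m.prod mE) _ F) :
    @lintegral Ω mΩ P (fun ω => F (ω, Z ω)) =
      @lintegral Ω mΩ P (fun ω => ∫⁻ z, F (ω, z) ∂(@Measure.map _ _ mΩ _ Z P)) := by
  have hidm : @Measurable Ω Ω mΩ m id := fun s hs => hm s hs
  have hI : @IndepFun Ω Ω E mΩ m mE id Z P := by
    rw [IndepFun_iff_Indep]
    rwa [MeasurableSpace.comap_id]
  exact @lintegral_comp_eq_of_indepFun Ω mΩ P E Ω mE m _ id Z hidm hZ hI F hF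

lemma lintegral_exp_mul_sub_gaussianReal (σ a : ℝ) :
    ∫⁻ e, ENNReal.ofReal (Real.exp (a * e - σ ^ 2 / 2 * a ^ 2))
      ∂(gaussianReal 0 (σ ^ 2).toNNReal) = 1 := by
  have hint := integrable_exp_mul_gaussianReal (μ := 0) (v := (σ ^ 2).toNNReal) a
  have hmgf := mgf_gaussianReal (p := gaussianReal 0 (σ ^ 2).toNNReal) (X := id) (μ := 0)
    (v := (σ ^ 2).toNNReal) (by simp) a
  rw [← ofReal_integral_eq_lintegral_ofReal]
  · simp only [sub_eq_add_neg, Real.exp_add, integral_mul_const]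
    have : ∫ e, Real.exp (a * e) ∂(gaussianReal 0 (σ ^ 2).toNNReal)
      = Real.exp (σ ^ 2 * a ^ 2 / 2) := by
      simpa [mgf, Real.coe_toNNReal _ (sq_nonneg σ)] using hmgf
    rw [this, ← Real.exp_add]
    simp
    ring
  · simp only [sub_eq_add_neg, Real.exp_add]
    exact hint.mul_const _
  · exact ae_of_all _ fun e => (Real.exp_pos _).le

/-- The information contained in the pairs `(x_t, ε_t)`, `1 ≤ t < i`. -/
@[reducible]
def past {p : ℕ} (x : ℕ → Ω → Vec (Fin p)) (ε : ℕ → Ω → ℝ) (i : ℕ) : MeasurableSpace Ω :=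
  ⨆ t ∈ Set.Ico 1 i, MeasurableSpace.comap (fun ω => (x t ω, ε t ω)) inferInstance

variable {p : ℕ} {Sig : Matrix (Fin p) (Fin p) ℝ} {σ : ℝ} {x : ℕ → Ω → Vec (Fin p)}
  {ε : ℕ → Ω → ℝ}

omit mΩ in
lemma past_mono {i j : ℕ} (h : i ≤ j) : past x ε i ≤ past x ε j :=
  biSup_mono fun _ ht => ⟨ht.1, ht.2.trans_le h⟩

omit mΩ in
lemma comap_le_past {i t : ℕ} (h1 : 1 ≤ t) (h2 : t < i) :
    MeasurableSpace.comap (fun ω => (x t ω, ε t ω)) inferInstance ≤ past x ε i :=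
  le_biSup (fun t => MeasurableSpace.comap (fun ω => (x t ω, ε t ω)) inferInstance)
    (show t ∈ Set.Ico 1 i from ⟨h1, h2⟩)

lemma IsGaussianStream.past_le (h : IsGaussianStream P Sig σ x ε) (i : ℕ) : past x ε i ≤ mΩ :=
  iSup₂_le fun t _ => ((h.measurable_x t).prodMk (h.measurable_eps t)).comap_le

lemma IsGaussianStream.indep_past (h : IsGaussianStream P Sig σ x ε) (i : ℕ) :
    Indep (past x ε i) (MeasurableSpace.comap (fun ω => (x i ω, ε i ω)) inferInstance) P := by
  have := indep_iSup_of_disjoint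
    (fun t => ((h.measurable_x t).prodMk (h.measurable_eps t)).comap_le) h.indep
    (S := Set.Ico 1 i) (T := {i}) (by simp)
  simpa [past] using this

omit mΩ in
lemma measurable_past {i t : ℕ} (h1 : 1 ≤ t) (h2 : t < i) :
    Measurable[past x ε i] (x t) ∧ Measurable[past x ε i] (ε t) := by
  have h : Measurable[past x ε i] (fun ω => (x t ω, ε t ω)) :=
    Measurable.mono (comap_measurable _) (comap_le_past h1 h2) le_rfl
  exact ⟨measurable_fst.comp h, measurable_snd.comp h⟩

/-- Given the past and the new covariate, the last noise variable is centred Gaussian with variance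
σ² and its coefficient ⟪x, c⟫ is a constant, so the last factor has conditional mean 1. Induction
removes the factors one at a time. -/
lemma IsGaussianStream.lintegral_exp_le (h : IsGaussianStream P Sig σ x ε)
    [IsProbabilityMeasure P] {c : ℕ → Ω → Vec (Fin p)} (N : ℕ)
    (hc : ∀ i, 1 ≤ i → i ≤ N → Measurable[past x ε i] (c i)) :
    ∫⁻ ω, ENNReal.ofReal (Real.exp (∑ i ∈ Finset.Icc 1 N,
      (⟪x i ω, c i ω⟫ * ε i ω - σ ^ 2 / 2 * ⟪x i ω, c i ω⟫ ^ 2))) ∂P = 1 := by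
  induction N with
  | zero => simp
  | succ N ih =>
    have hle := h.past_le (N + 1)
    have hcm := hc (N + 1) (by omega) le_rfl
    have hsum : Measurable[past x ε (N + 1)] (fun ω => ∑ i ∈ Finset.Icc 1 N,
        (⟪x i ω, c i ω⟫ * ε i ω - σ ^ 2 / 2 * ⟪x i ω, c i ω⟫ ^ 2)) := by
      refine Finset.measurable_sum _ fun i hi => ?_
      rw [Finset.mem_Icc] at hi
      have hx := measurable_past (x := x) (ε := ε) hi.1 (show i < N + 1 by omega)
      have hci : Measurable[past x ε (N + 1)] (c i) :=
        (hc i hi.1 (by omega)).mono (past_mono (by omega)) le_rfl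
      have hin := hx.1.inner (𝕜 := ℝ) hci
      exact (hin.mul hx.2).sub ((hin.pow_const 2).const_mul _)
    rw [← ih fun i h1 h2 => hc i h1 (by omega)]
    let F : Ω × (Vec (Fin p) × ℝ) → ENNReal := fun q => ENNReal.ofReal (Real.exp (
      (∑ i ∈ Finset.Icc 1 N,
        (⟪x i q.1, c i q.1⟫ * ε i q.1 - σ ^ 2 / 2 * ⟪x i q.1, c i q.1⟫ ^ 2)) +
      (⟪q.2.1, c (N + 1) q.1⟫ * q.2.2 - σ ^ 2 / 2 * ⟪q.2.1, c (N + 1) q.1⟫ ^ 2)))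
    have hF : @Measurable _ _ ((past x ε (N + 1)).prod inferInstance) _ F := by
      have h1 : @Measurable _ _ ((past x ε (N + 1)).prod inferInstance) (past x ε (N + 1))
          (fun q : Ω × (Vec (Fin p) × ℝ) => q.1) :=
        @measurable_fst _ _ (past x ε (N + 1)) _
      have h2 : @Measurable _ _ ((past x ε (N + 1)).prod inferInstance) _
          (fun q : Ω × (Vec (Fin p) × ℝ) => q.2) :=
        @measurable_snd _ _ (past x ε (N + 1)) _
      have hin := (measurable_fst.comp h2).inner (𝕜 := ℝ) (hcm.comp h1)
      exact (((hsum.comp h1).add ((hin.mul (measurable_snd.comp h2)).sub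
        ((hin.pow_const 2).const_mul _))).exp).ennreal_ofReal
    have hkey := lintegral_comp_eq_of_indep _ hle
      ((h.measurable_x (N + 1)).prodMk (h.measurable_eps (N + 1))) (h.indep_past (N + 1)) hF
    calc _ = ∫⁻ ω, F (ω, (x (N + 1) ω, ε (N + 1) ω)) ∂P := by
          refine lintegral_congr fun ω => ?_
          rw [Finset.sum_Icc_succ_top (by omega)]
      _ = _ := hkey
      _ = _ := by
          refine lintegral_congr fun ω => ?_
          rw [h.law, lintegral_prod _ (by
            have : Measurable (F ∘ fun z => (ω, z)) :=
              hF.comp (@measurable_prodMk_left _ _ (past x ε (N + 1)) _ ω)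
            exact this.aemeasurable)]
          simp only [F, Real.exp_add, ENNReal.ofReal_mul (Real.exp_pos _).le]
          simp_rw [lintegral_const_mul' _ _ ENNReal.ofReal_ne_top,
            lintegral_exp_mul_sub_gaussianReal]
          simp

/-- Exponential deviation bound for the martingale `∑ ε_i ⟪x_i, c_i⟫`, `c` predictable. -/
lemma IsGaussianStream.measure_sum_ge_le (h : IsGaussianStream P Sig σ x ε)
    [IsProbabilityMeasure P] {c : ℕ → Ω → Vec (Fin p)} (N : ℕ)
    (hc : ∀ i, 1 ≤ i → i ≤ N → Measurable[past x ε i] (c i)) {l : ℝ} (hl : 0 < l) (u : ℝ) :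
    P {ω | l * σ ^ 2 / 2 * ∑ i ∈ Finset.Icc 1 N, ⟪x i ω, c i ω⟫ ^ 2 + u / l ≤
      ∑ i ∈ Finset.Icc 1 N, ε i ω * ⟪x i ω, c i ω⟫} ≤ ENNReal.ofReal (Real.exp (-u)) := by
  have hc' : ∀ i, 1 ≤ i → i ≤ N → Measurable[past x ε i] (fun ω => l • c i ω) :=
    fun i h1 h2 => (hc i h1 h2).const_smul l
  -- The mean-one identity is applied to l • c; Markov's inequality at level exp u, divided by l, is
  -- the claim.
  have h1 := h.lintegral_exp_le N hc'
  set f : Ω → ℝ := fun ω => ∑ i ∈ Finset.Icc 1 N,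
      (⟪x i ω, l • c i ω⟫ * ε i ω - σ ^ 2 / 2 * ⟪x i ω, l • c i ω⟫ ^ 2) with hf
  have hfm : Measurable f := by
    refine Finset.measurable_sum _ fun i hi => ?_
    rw [Finset.mem_Icc] at hi
    have hin := (h.measurable_x i).inner (𝕜 := ℝ) ((hc' i hi.1 hi.2).mono (h.past_le i) le_rfl)
    exact (hin.mul (h.measurable_eps i)).sub ((hin.pow_const 2).const_mul _)
  have hM := mul_meas_ge_le_lintegral (μ := P) (hfm.exp.ennreal_ofReal)
    (ENNReal.ofReal (Real.exp u))
  rw [h1] at hM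
  have hsub : {ω | l * σ ^ 2 / 2 * ∑ i ∈ Finset.Icc 1 N, ⟪x i ω, c i ω⟫ ^ 2 + u / l ≤
      ∑ i ∈ Finset.Icc 1 N, ε i ω * ⟪x i ω, c i ω⟫} ⊆
      {ω | ENNReal.ofReal (Real.exp u) ≤ ENNReal.ofReal (Real.exp (f ω))} := by
    intro ω hω
    simp only [Set.mem_ofPred_eq] at hω ⊢
    refine ENNReal.ofReal_le_ofReal (Real.exp_le_exp.2 ?_)
    have h2 := mul_le_mul_of_nonneg_left hω hl.le
    have h3 : f ω = l * ∑ i ∈ Finset.Icc 1 N, ε i ω * ⟪x i ω, c i ω⟫ -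
        l ^ 2 * σ ^ 2 / 2 * ∑ i ∈ Finset.Icc 1 N, ⟪x i ω, c i ω⟫ ^ 2 := by
      rw [hf, Finset.mul_sum, Finset.mul_sum, ← Finset.sum_sub_distrib]
      refine Finset.sum_congr rfl fun i _ => ?_
      rw [real_inner_smul_right]
      ring
    have h4 : l * (l * σ ^ 2 / 2 * ∑ i ∈ Finset.Icc 1 N, ⟪x i ω, c i ω⟫ ^ 2 + u / l) =
        l ^ 2 * σ ^ 2 / 2 * ∑ i ∈ Finset.Icc 1 N, ⟪x i ω, c i ω⟫ ^ 2 + u := by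
      field_simp
    rw [h3]
    linarith
  refine (measure_mono hsub).trans ?_
  rw [Real.exp_neg, ENNReal.ofReal_inv_of_pos (Real.exp_pos u), ENNReal.le_inv_iff_mul_le, mul_comm]
  exact hM

end ExpMartingale

end OLSth

namespace OLSth

/-! ### Small-ball estimate for p nondegenerate Gaussian samples. -/

section Nondegenerate

variable {p : ℕ} {Sig : Matrix (Fin p) (Fin p) ℝ}

/-- ⟪v, z⟫ is a real Gaussian of variance vᵀΣv > 0, hence has no atoms. -/
lemma multivariateGaussian_inner_eq_zero (hSig : Sig.PosDef) {v : Vec (Fin p)} (hv : v ≠ 0) :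
    multivariateGaussian 0 Sig {z | ⟪v, z⟫ = 0} = 0 := by
  set μ := multivariateGaussian (0 : Vec (Fin p)) Sig
  have hmap := IsGaussian.map_eq_gaussianReal (μ := μ) (innerSL ℝ v)
  have hvar : Var[innerSL ℝ v; μ] = v.ofLp ⬝ᵥ Matrix.mulVec Sig v.ofLp := by
    rw [← covarianceBilin_multivariateGaussian (μ := 0) hSig.posSemidef,
      covarianceBilin_self IsGaussian.memLp_two_id]
    rfl
  have hpos : 0 < v.ofLp ⬝ᵥ Matrix.mulVec Sig v.ofLp := by
    have := hSig.dotProduct_mulVec_pos (x := v.ofLp) (by simpa using hv)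
    simpa using this
  have hne : (Var[innerSL ℝ v; μ]).toNNReal ≠ 0 := by
    rw [hvar]; simpa using hpos
  have := nullSingletonClass_gaussianReal (μ := ∫ z, innerSL ℝ v z ∂μ) hne
  have h0 : μ.map (innerSL ℝ v) {0} = 0 := by rw [hmap]; exact measure_singleton 0
  rw [Measure.map_apply (by fun_prop) (measurableSet_singleton 0)] at h0
  exact h0

lemma multivariateGaussian_submodule (hSig : Sig.PosDef) {W : Submodule ℝ (Vec (Fin p))}
    (hW : W ≠ ⊤) : multivariateGaussian 0 Sig (W : Set (Vec (Fin p))) = 0 := by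
  have hne : Wᗮ ≠ ⊥ := by rwa [Ne, Submodule.orthogonal_eq_bot_iff]
  obtain ⟨v, hv, hv0⟩ := Submodule.exists_mem_ne_zero_of_ne_bot hne
  refine measure_mono_null (fun z hz => ?_) (multivariateGaussian_inner_eq_zero hSig hv0)
  exact Submodule.inner_left_of_mem_orthogonal hz hv

/-- At most `p` independent samples of a nondegenerate Gaussian vector are almost surely linearly
independent. -/
lemma pi_multivariateGaussian_linearIndependent (hSig : Sig.PosDef) (q : ℕ) (hq : q ≤ p) :
    ∀ᵐ f ∂(Measure.pi fun _ : Fin q => multivariateGaussian (0 : Vec (Fin p)) Sig),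
      LinearIndependent ℝ f := by
  induction q with
  | zero => exact ae_of_all _ fun f => linearIndependent_empty_type
  | succ q ih =>
    set μ := multivariateGaussian (0 : Vec (Fin p)) Sig
    have hmeas : MeasurableSet {f : Fin (q + 1) → Vec (Fin p) | LinearIndependent ℝ f} :=
      isOpen_setOfPred_linearIndependent.measurableSet
    let e := MeasurableEquiv.piFinSuccAbove (fun _ : Fin (q + 1) => Vec (Fin p)) 0
    have hmp := (measurePreserving_piFinSuccAbove (fun _ : Fin (q + 1) => μ) 0).symm
    rw [← hmp.map_eq, ae_map_iff (by fun_prop) hmeas]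
    have hmeas2 : MeasurableSet {w : Vec (Fin p) × (Fin q → Vec (Fin p)) |
        LinearIndependent ℝ (e.symm w)} := e.symm.measurable hmeas
    have hswap := Measure.measurePreserving_swap (μ := Measure.pi fun _ : Fin q => μ) (ν := μ)
    rw [← hswap.map_eq, ae_map_iff (by fun_prop) hmeas2]
    refine (Measure.ae_prod_iff_ae_ae (measurable_swap hmeas2)).2 ?_
    filter_upwards [ih (by omega)] with f hf
    have hW : Submodule.span ℝ (Set.range f) ≠ ⊤ := by
      intro htop
      have h1 := finrank_span_eq_card hf
      rw [htop, finrank_top] at h1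
      simp at h1
      omega
    have := multivariateGaussian_submodule hSig hW
    rw [measure_eq_zero_iff_ae_notMem] at this
    filter_upwards [this] with z hz
    have : e.symm (Prod.swap (f, z)) = Fin.cons z f := by
      simp [e, MeasurableEquiv.piFinSuccAbove, Fin.insertNthEquiv]
    rw [this]
    exact linearIndependent_finCons.2 ⟨hf, hz⟩

/-- The tuples `f` with `c ‖v‖² ≤ ∑ ⟪f_t, v⟫²` for all `v`. -/
def goodTuples (p : ℕ) (c : ℝ) : Set (Fin p → Vec (Fin p)) :=
  {f | ∀ v, c * ‖v‖ ^ 2 ≤ ∑ t, ⟪f t, v⟫ ^ 2}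

lemma measurableSet_goodTuples (p : ℕ) (c : ℝ) : MeasurableSet (goodTuples p c) := by
  refine IsClosed.measurableSet ?_
  simp only [goodTuples, Set.ofPred_forall]
  refine isClosed_iInter fun v => isClosed_le (by fun_prop) (by fun_prop)

/-- The rows f_t span, so v ↦ (⟪f_t, v⟫)_t is injective; in finite dimension it is then bounded
below. -/
lemma exists_mem_goodTuples {f : Fin p → Vec (Fin p)} (hf : LinearIndependent ℝ f) :
    ∃ k : ℕ, f ∈ goodTuples p (1 / ((k : ℝ) + 1)) := by
  have hspan : Submodule.span ℝ (Set.range f) = ⊤ :=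
    hf.span_eq_top_of_card_eq_finrank' (by simp)
  let T : Vec (Fin p) →ₗ[ℝ] Vec (Fin p) :=
    { toFun := fun v => WithLp.toLp 2 fun t => ⟪f t, v⟫
      map_add' := fun v w => by ext t; simp [inner_add_right]
      map_smul' := fun a v => by ext t; simp [real_inner_smul_right] }
  have hker : LinearMap.ker T = ⊥ := by
    rw [LinearMap.ker_eq_bot']
    intro v hv
    have h1 : ∀ t, ⟪f t, v⟫ = 0 := fun t => by
      simpa [T] using congrArg (fun w : Vec (Fin p) => w t) hv
    have h2 : v ∈ (Submodule.span ℝ (Set.range f))ᗮ := by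
      rw [Submodule.mem_orthogonal]
      intro w hw
      induction hw using Submodule.span_induction with
      | mem w hw => obtain ⟨t, rfl⟩ := hw; exact h1 t
      | zero => simp
      | add a b _ _ ha hb => rw [inner_add_left, ha, hb, add_zero]
      | smul a w _ hw => rw [real_inner_smul_left, hw, mul_zero]
    rw [hspan, Submodule.top_orthogonal_eq_bot] at h2
    simpa using h2
  obtain ⟨K, hK, hanti⟩ := T.exists_antilipschitzWith hker
  obtain ⟨k, hk⟩ := exists_nat_ge ((K : ℝ) ^ 2)
  refine ⟨k, fun v => ?_⟩
  have h1 : ‖v‖ ≤ K * ‖T v‖ := by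
    simpa using hanti.le_mul_dist v 0
  have h2 : ‖T v‖ ^ 2 = ∑ t, ⟪f t, v⟫ ^ 2 := by
    simp [T, EuclideanSpace.real_norm_sq_eq]
  rw [← h2, one_div, inv_mul_le_iff₀ (by positivity)]
  calc ‖v‖ ^ 2 ≤ (K * ‖T v‖) ^ 2 := by gcongr
    _ = K ^ 2 * ‖T v‖ ^ 2 := by ring
    _ ≤ (k + 1) * ‖T v‖ ^ 2 := by gcongr; linarith

/-- The bad sets decrease to a null set as the constant tends to 0, so continuity from above gives
some c, without an explicit value. -/
lemma exists_goodTuples_compl_le (hSig : Sig.PosDef) {δ : ℝ} (hδ : 0 < δ) :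
    ∃ c : ℝ, 0 < c ∧ (Measure.pi fun _ : Fin p => multivariateGaussian (0 : Vec (Fin p)) Sig)
      (goodTuples p c)ᶜ ≤ ENNReal.ofReal δ := by
  set π := Measure.pi fun _ : Fin p => multivariateGaussian (0 : Vec (Fin p)) Sig
  let s : ℕ → Set (Fin p → Vec (Fin p)) := fun k => (goodTuples p (1 / ((k : ℝ) + 1)))ᶜ
  have hanti : Antitone s := by
    intro a b hab f hf hfa
    refine hf fun v => le_trans ?_ (hfa v)
    gcongr
  have hlim := tendsto_measure_iInter_atTop (μ := π) (s := s)
    (fun k => (measurableSet_goodTuples p _).compl.nullMeasurableSet) hanti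
    ⟨0, measure_ne_top _ _⟩
  have hzero : π (⋂ k, s k) = 0 := by
    rw [measure_eq_zero_iff_ae_notMem]
    filter_upwards [pi_multivariateGaussian_linearIndependent hSig p le_rfl] with f hf hmem
    obtain ⟨k, hk⟩ := exists_mem_goodTuples hf
    exact Set.mem_iInter.1 hmem k hk
  rw [hzero] at hlim
  have hev := hlim.eventually_lt_const (u := ENNReal.ofReal δ) (by simpa using hδ)
  obtain ⟨k, hk⟩ := hev.exists
  exact ⟨_, by positivity, hk.le⟩

end Nondegenerate

/-! ### Independent blocks, smallest eigenvalue and norm sums. -/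

section Blocks

variable {Ω : Type*} [MeasurableSpace Ω] {P : Measure Ω}

/-- Consecutive blocks of length `q` of a sequence of independent variables are independent. -/
lemma iIndepFun_blocks {E : Type*} [MeasurableSpace E] {x : ℕ → Ω → E}
    (hind : iIndepFun x P) (hm : ∀ i, Measurable (x i)) (q : ℕ) :
    iIndepFun (fun (k : ℕ) ω (j : Fin q) => x (k * q + j + 1) ω) P := by
  have := hind.isProbabilityMeasure
  have hinj : Function.Injective fun a : ℕ × Fin q => a.1 * q + a.2 + 1 := by
    rintro ⟨a, i⟩ ⟨b, j⟩ h
    have hq : 0 < q := i.pos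
    have h' : a * q + i = b * q + j := by simpa using h
    have h1 : a = b := by
      have := congrArg (· / q) h'
      simpa [Nat.add_div_of_dvd_right, Nat.mul_div_cancel _ hq, Nat.div_eq_of_lt i.2,
        Nat.div_eq_of_lt j.2, Nat.add_comm, Nat.add_mul_div_right _ _ hq] using this
    subst h1
    simp only [Prod.mk.injEq, true_and]
    exact Fin.ext (by omega)
  have h1 := hind.precomp hinj
  have hprob : ∀ i, IsProbabilityMeasure (P.map (x i)) := fun i =>
    Measure.isProbabilityMeasure_map (hm i).aemeasurable
  have h2 := (iIndepFun_iff_map_fun_eq_infinitePi_map (fun a => hm _)).1 h1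
  rw [iIndepFun_iff_map_fun_eq_infinitePi_map (fun k => measurable_pi_lambda _ fun j => hm _)]
  have h3 := Measure.infinitePi_map_curry (fun (k : ℕ) (j : Fin q) => P.map (x (k * q + j + 1)))
  have h4 : (MeasurableEquiv.curry ℕ (Fin q) E) ∘
      (fun ω (a : ℕ × Fin q) => x (a.1 * q + a.2 + 1) ω) =
      fun ω k (j : Fin q) => x (k * q + j + 1) ω := rfl
  rw [← h4, ← Measure.map_map (by fun_prop) (measurable_pi_lambda _ fun a => hm _), h2, h3]
  congr 1
  ext1 k
  have h5 : iIndepFun (fun (j : Fin q) => x (k * q + j + 1)) P :=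
    hind.precomp (g := fun j : Fin q => k * q + j + 1) fun i j h => Fin.ext (by simpa using h)
  rw [(iIndepFun_iff_map_fun_eq_infinitePi_map (fun j => hm _)).1 h5]

lemma sum_Icc_one_eq_sum_range (g : ℕ → ℝ) (N : ℕ) :
    ∑ t ∈ Finset.Icc 1 N, g t = ∑ t ∈ Finset.range N, g (t + 1) := by
  induction N with
  | zero => simp
  | succ N ih => rw [Finset.sum_Icc_succ_top (by omega), Finset.sum_range_succ, ih]

lemma sum_blocks_le {g : ℕ → ℝ} (hg : ∀ t, 0 ≤ g t) (q N : ℕ) :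
    ∑ k ∈ Finset.range (N / q), ∑ j : Fin q, g (k * q + j + 1) ≤ ∑ t ∈ Finset.Icc 1 N, g t := by
  have h : ∀ K : ℕ, ∑ k ∈ Finset.range K, ∑ j : Fin q, g (k * q + j + 1) =
      ∑ t ∈ Finset.range (K * q), g (t + 1) := fun K => by
    induction K with
    | zero => simp
    | succ K ih =>
      rw [Finset.sum_range_succ, ih, Nat.succ_mul, Finset.sum_range_add,
        Finset.sum_range (fun i => g (K * q + i + 1))]
  rw [h, sum_Icc_one_eq_sum_range]
  exact Finset.sum_le_sum_of_subset_of_nonneg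
    (Finset.range_mono (Nat.div_mul_le_self N q)) fun t _ _ => hg _

variable {p : ℕ} {Sig : Matrix (Fin p) (Fin p) ℝ} {σ : ℝ} {x : ℕ → Ω → Vec (Fin p)}
  {ε : ℕ → Ω → ℝ}

lemma IsGaussianStream.iIndepFun_x (h : IsGaussianStream P Sig σ x ε) : iIndepFun x P :=
  h.indep.comp (fun _ z => z.1) fun _ => measurable_fst

lemma IsGaussianStream.iIndepFun_eps (h : IsGaussianStream P Sig σ x ε) : iIndepFun ε P :=
  h.indep.comp (fun _ z => z.2) fun _ => measurable_snd

lemma IsGaussianStream.map_x (h : IsGaussianStream P Sig σ x ε) (i : ℕ) :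
    P.map (x i) = multivariateGaussian 0 Sig := by
  have h1 := congrArg (Measure.map Prod.fst) (h.law i)
  rw [Measure.map_map measurable_fst ((h.measurable_x i).prodMk (h.measurable_eps i)),
    Measure.map_fst_prod] at h1
  simpa [Function.comp_def] using h1

lemma IsGaussianStream.map_eps (h : IsGaussianStream P Sig σ x ε) (i : ℕ) :
    P.map (ε i) = gaussianReal 0 (σ ^ 2).toNNReal := by
  have h1 := congrArg (Measure.map Prod.snd) (h.law i)
  rw [Measure.map_map measurable_snd ((h.measurable_x i).prodMk (h.measurable_eps i)),
    Measure.map_snd_prod] at h1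
  simpa [Function.comp_def] using h1

lemma IsGaussianStream.map_block (h : IsGaussianStream P Sig σ x ε) [IsProbabilityMeasure P]
    (k q : ℕ) : P.map (fun ω (j : Fin q) => x (k * q + j + 1) ω) =
      Measure.pi fun _ => multivariateGaussian 0 Sig := by
  have h5 : iIndepFun (fun (j : Fin q) => x (k * q + j + 1)) P :=
    h.iIndepFun_x.precomp (g := fun j : Fin q => k * q + j + 1)
      fun i j h => Fin.ext (by simpa using h)
  rw [(iIndepFun_iff_map_fun_eq_pi_map fun j => (h.measurable_x _).aemeasurable).1 h5]
  simp_rw [h.map_x]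

/-- The smallest eigenvalue of `∑_{t ≤ N} x_t x_tᵀ` is at least of order `N`, outside of an event
of exponentially small probability. -/
lemma exists_measure_not_eigenvalue_bound_le (hp : 0 < p) (hSig : Sig.PosDef) {T : ℝ}
    (hT : 0 < T) (σ : ℝ) :
    ∃ c : ℝ, 0 < c ∧ ∀ (Ω : Type*) [MeasurableSpace Ω] (P : Measure Ω) [IsProbabilityMeasure P]
      (x : ℕ → Ω → Vec (Fin p)) (ε : ℕ → Ω → ℝ), IsGaussianStream P Sig σ x ε → ∀ N, p ≤ N →
      P {ω | ¬ ∀ v, c * N * ‖v‖ ^ 2 ≤ ∑ t ∈ Finset.Icc 1 N, ⟪x t ω, v⟫ ^ 2} ≤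
        ENNReal.ofReal (Real.exp (-(T * N))) := by
  have hp' : (0 : ℝ) < p := by exact_mod_cast hp
  -- A bad block has probability at most δ = a exp(-s), so its indicator has exponential moment at
  -- most 1 + a at s. With K blocks and u = Ka the Chernoff threshold is 2Ka/s = K/2: half of the
  -- blocks are good except with probability exp(-Ka), and Ka ≥ TN.
  set a : ℝ := 2 * p * T with ha
  have ha0 : 0 < a := by positivity
  set s : ℝ := 4 * a with hs
  set δ : ℝ := a * Real.exp (-s) with hδ
  obtain ⟨c, hc, hcδ⟩ := exists_goodTuples_compl_le hSig (δ := δ) (by positivity)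
  refine ⟨c / (4 * p), by positivity, fun Ω _ P _ x ε h N hN => ?_⟩
  set X : ℕ → Ω → (Fin p → Vec (Fin p)) := fun k ω j => x (k * p + j + 1) ω with hX
  have hXm : ∀ k, Measurable (X k) := fun k => measurable_pi_lambda _ fun j => h.measurable_x _
  set φ : (Fin p → Vec (Fin p)) → ℝ := (goodTuples p c)ᶜ.indicator fun _ => 1 with hφ
  have hφm : Measurable φ :=
    measurable_const.indicator (measurableSet_goodTuples p c).compl
  have hφ0 : ∀ f, 0 ≤ φ f := fun f => Set.indicator_nonneg (fun _ _ => zero_le_one) f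
  have hφ1 : ∀ f, φ f ≤ 1 := fun f => Set.indicator_le_self' (fun _ _ => zero_le_one) f
  have hind : iIndepFun (fun k => φ ∘ X k) P :=
    (iIndepFun_blocks h.iIndepFun_x h.measurable_x p).comp (fun _ => φ) fun _ => hφm
  have hmem : ∀ k, P.real (X k ⁻¹' (goodTuples p c)ᶜ) ≤ δ := fun k => by
    rw [← h.map_block k p, Measure.map_apply (hXm k) (measurableSet_goodTuples p c).compl] at hcδ
    exact ENNReal.toReal_le_of_le_ofReal (by positivity) hcδ
  have hexp : ∀ k ω, Real.exp (s * (φ ∘ X k) ω) =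
      1 + (X k ⁻¹' (goodTuples p c)ᶜ).indicator (fun _ => Real.exp s - 1) ω := fun k ω => by
    by_cases hω : X k ω ∈ goodTuples p c <;> simp [φ, hω]
  have hmset : ∀ k, MeasurableSet (X k ⁻¹' (goodTuples p c)ᶜ) := fun k =>
    hXm k (measurableSet_goodTuples p c).compl
  have hindint : ∀ k, Integrable
      ((X k ⁻¹' (goodTuples p c)ᶜ).indicator (fun _ => Real.exp s - 1)) P := fun k =>
    (integrable_const _).indicator (hmset k)
  have hint : ∀ k, Integrable (fun ω => Real.exp (s * (φ ∘ X k) ω)) P := fun k => by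
    simp_rw [hexp]
    exact (integrable_const _).add (hindint k)
  have hmgf : ∀ k, mgf (φ ∘ X k) P s ≤ 1 + a := fun k => by
    simp only [mgf, hexp]
    rw [integral_add (integrable_const _) (hindint k), integral_indicator_const _ (hmset k)]
    simp only [integral_const, probReal_univ, smul_eq_mul, mul_one]
    have h1 : P.real (X k ⁻¹' (goodTuples p c)ᶜ) * (Real.exp s - 1) ≤ δ * Real.exp s := by
      have := Real.add_one_le_exp s
      exact mul_le_mul (hmem k) (by linarith) (by linarith) (by positivity)
    have h2 : δ * Real.exp s = a := by
      rw [hδ, mul_assoc, ← Real.exp_add]; simp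
    linarith
  set K := N / p with hKdef
  have hch := measure_weighted_sum_ge_le hind (fun k => hφm.comp (hXm k))
    (fun k ω => hφ0 _) (s := s) (K := a) (by positivity) hint hmgf (Finset.range K)
    (w := fun _ => 1) (fun _ => by simp) (K * a)
  -- Since N ≥ p there is at least one full block, so rounding down costs at most a factor 2.
  have hNK : (N : ℝ) ≤ 2 * p * K := by
    have h1 : N < p * (K + 1) := Nat.lt_mul_div_succ N hp
    have h2 : 1 ≤ K := Nat.div_pos hN hp
    have h3 : N ≤ 2 * p * K := by nlinarith
    exact_mod_cast h3
  refine (measure_mono ?_).trans (hch.trans (ENNReal.ofReal_le_ofReal (Real.exp_le_exp.2 ?_)))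
  · intro ω hω
    simp only [Set.mem_ofPred_eq] at hω ⊢
    by_contra hlt
    refine hω fun v => ?_
    have hlt' : ∑ k ∈ Finset.range K, φ (X k ω) < K / 2 := by
      refine (not_le.1 hlt |>.trans_le' (by simp)).trans_le (le_of_eq ?_)
      simp [hs]
      field_simp
      ring
    have hblock : ∀ k, (1 - φ (X k ω)) * (c * ‖v‖ ^ 2) ≤
        ∑ j : Fin p, ⟪x (k * p + j + 1) ω, v⟫ ^ 2 := fun k => by
      by_cases hk : X k ω ∈ goodTuples p c
      · have : φ (X k ω) = 0 := by simp [φ, hk]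
        rw [this, sub_zero, one_mul]
        exact hk v
      · have : φ (X k ω) = 1 := by simp [φ, hk]
        rw [this, sub_self, zero_mul]
        positivity
    have h1 := sum_blocks_le (g := fun t => ⟪x t ω, v⟫ ^ 2) (fun t => sq_nonneg _) p N
    have h2 := Finset.sum_le_sum fun k (_ : k ∈ Finset.range K) => hblock k
    rw [← Finset.sum_mul, Finset.sum_sub_distrib] at h2
    simp only [Finset.sum_const, Finset.card_range, nsmul_eq_mul, mul_one] at h2
    have h3 : (K / 2 : ℝ) * (c * ‖v‖ ^ 2) ≤
        (K - ∑ k ∈ Finset.range K, φ (X k ω)) * (c * ‖v‖ ^ 2) := by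
      gcongr; linarith
    have h4 : c / (4 * p) * N * ‖v‖ ^ 2 ≤ (K / 2 : ℝ) * (c * ‖v‖ ^ 2) := by
      have : c / (4 * p) * N ≤ K / 2 * c := by
        rw [div_mul_eq_mul_div, div_le_iff₀ (by positivity)]
        nlinarith
      nlinarith [mul_le_mul_of_nonneg_right this (sq_nonneg ‖v‖)]
    linarith
  · rw [ha]
    nlinarith

/-- Deviation bound for weighted sums of squared norms of i.i.d. Gaussian vectors. -/
lemma exists_measure_weighted_sum_norm_sq_ge_le {E : Type*} [NormedAddCommGroup E]
    [NormedSpace ℝ E] [MeasurableSpace E] [BorelSpace E] [SecondCountableTopology E]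
    [CompleteSpace E] (μ : Measure E) [IsGaussian μ] :
    ∃ A : ℝ, 0 < A ∧ ∀ (Ω : Type*) [MeasurableSpace Ω] (P : Measure Ω) [IsProbabilityMeasure P]
      (x : ℕ → Ω → E), iIndepFun x P → (∀ i, Measurable (x i)) → (∀ i, P.map (x i) = μ) →
      ∀ (I : Finset ℕ) (w : ℕ → ℝ), (∀ i, 0 ≤ w i ∧ w i ≤ 1) → ∀ u, 0 ≤ u →
      P {ω | A * (∑ i ∈ I, w i + u) ≤ ∑ i ∈ I, w i * ‖x i ω‖ ^ 2} ≤
        ENNReal.ofReal (Real.exp (-u)) := by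
  obtain ⟨s, hs, hint⟩ := IsGaussian.exists_integrable_exp_sq μ
  set K := ∫ z, Real.exp (s * ‖z‖ ^ 2) ∂μ with hK
  have hK0 : 0 ≤ K := integral_nonneg fun z => (Real.exp_pos _).le
  refine ⟨(K + 1) / s, by positivity, fun Ω _ P _ x hind hm hmap I w hw u hu => ?_⟩
  have hφ : Measurable fun z : E => ‖z‖ ^ 2 := by fun_prop
  have hch := measure_weighted_sum_ge_le (Z := fun i ω => ‖x i ω‖ ^ 2) (P := P) (s := s) (K := K)
    (hind.comp (fun _ z => ‖z‖ ^ 2) fun _ => hφ) (fun i => hφ.comp (hm i))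
    (fun i ω => by positivity) hs
    (fun i => by
      have := hint
      rw [← hmap i] at this
      exact this.comp_measurable (hm i))
    (fun i => by
      have : mgf (fun ω => ‖x i ω‖ ^ 2) P s = K := by
        rw [hK, ← hmap i, integral_map (hm i).aemeasurable (by fun_prop)]
        rfl
      rw [this]; linarith) I hw u
  refine (measure_mono fun ω hω => ?_).trans hch
  simp only [Set.mem_ofPred_eq] at hω ⊢
  refine le_trans ?_ hω
  have hw0 : 0 ≤ ∑ i ∈ I, w i := Finset.sum_nonneg fun i _ => (hw i).1
  rw [div_mul_eq_mul_div]
  gcongr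
  nlinarith

end Blocks

end OLSth

namespace OLSth

/-! ### Deterministic error bounds for least squares with thresholding. -/

section LeastSquares

lemma IsLSFit.inner_eq {ι : Type*} [Fintype ι] {x : ℕ → Vec ι} {y : ℕ → ℝ} {r : ℝ} {i : ℕ}
    {b : Vec ι} (h : IsLSFit x y r i b) (v : Vec ι) :
    ∑ t ∈ Finset.Ico 1 i, ⟪x t, b⟫ * ⟪x t, v⟫ + r * ⟪b, v⟫ =
      ∑ t ∈ Finset.Ico 1 i, y t * ⟪x t, v⟫ := by
  have := congrArg (fun w => ⟪w, v⟫) h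
  simpa [inner_add_left, sum_inner, real_inner_smul_left] using this

variable {p : ℕ}

lemma inner_restrictTo (S : Finset (Fin p)) (u v : Vec (Fin p)) (hv : ∀ j ∉ S, v j = 0) :
    ⟪restrictTo S u, restrictTo S v⟫ = ⟪u, v⟫ := by
  simp only [PiLp.inner_apply, restrictTo]
  rw [Finset.sum_coe_sort S fun j => ⟪u j, v j⟫]
  exact Finset.sum_subset (Finset.subset_univ S) fun j _ hj => by simp [hv j hj]

/-- The normal equations of a least squares fit on the features in `S`, tested against vectors
supported in `S`. -/
lemma IsLSFit.inner_eq_of_restrictTo {x : ℕ → Vec (Fin p)} {y : ℕ → ℝ} {r : ℝ} {i : ℕ}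
    {b : Vec (Fin p)} {S : Finset (Fin p)}
    (h : IsLSFit (fun t => restrictTo S (x t)) y r i (restrictTo S b)) (hb : ∀ j ∉ S, b j = 0)
    {v : Vec (Fin p)} (hv : ∀ j ∉ S, v j = 0) :
    ∑ t ∈ Finset.Ico 1 i, ⟪x t, b⟫ * ⟪x t, v⟫ + r * ⟪b, v⟫ =
      ∑ t ∈ Finset.Ico 1 i, y t * ⟪x t, v⟫ := by
  simpa only [inner_restrictTo S _ _ hb, inner_restrictTo S _ _ hv] using
    h.inner_eq (restrictTo S v)

/-- Error bound for a solution `b` of normal equations, with `w` in the fitted subspace. -/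
lemma mul_norm_sub_le_of_normal_eq {I : Finset ℕ} {x : ℕ → Vec (Fin p)} {ε : ℕ → ℝ}
    {b β w : Vec (Fin p)} {r a E Q : ℝ} (hr : 0 ≤ r)
    (ha : ∀ v, a * ‖v‖ ^ 2 ≤ ∑ t ∈ I, ⟪x t, v⟫ ^ 2)
    (hE : ‖∑ t ∈ I, ε t • x t‖ ≤ E) (hQ : ∑ t ∈ I, ‖x t‖ ^ 2 ≤ Q)
    (hfit : ∑ t ∈ I, ⟪x t, b⟫ * ⟪x t, b - w⟫ + r * ⟪b, b - w⟫ =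
      ∑ t ∈ I, (⟪x t, β⟫ + ε t) * ⟪x t, b - w⟫) :
    a * ‖b - w‖ ≤ E + Q * ‖β - w‖ + r * ‖w‖ := by
  set d := b - w with hd
  set q := β - w with hq
  have hE0 : 0 ≤ E := (norm_nonneg _).trans hE
  have hQ0 : 0 ≤ Q := (Finset.sum_nonneg fun t _ => sq_nonneg _).trans hQ
  -- Energy identity: the normal equations tested against d itself. The right side holds the misfit
  -- β - w, the noise and the ridge bias.
  have h1 : ∑ t ∈ I, ⟪x t, d⟫ ^ 2 + r * ‖d‖ ^ 2 =
      ∑ t ∈ I, ⟪x t, q⟫ * ⟪x t, d⟫ + ⟪∑ t ∈ I, ε t • x t, d⟫ - r * ⟪w, d⟫ := by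
    have hbd : b = d + w := by rw [hd]; abel
    have hβ : β = q + w := by rw [hq]; abel
    clear_value d q
    subst hbd hβ
    simp only [inner_add_right, inner_add_left, add_mul, mul_add, Finset.sum_add_distrib,
      real_inner_self_eq_norm_sq, ← pow_two] at hfit
    simp only [sum_inner, real_inner_smul_left]
    linarith
  have h2 : ∑ t ∈ I, ⟪x t, q⟫ * ⟪x t, d⟫ ≤ Q * ‖q‖ * ‖d‖ := by
    calc ∑ t ∈ I, ⟪x t, q⟫ * ⟪x t, d⟫ ≤ ∑ t ∈ I, ‖x t‖ ^ 2 * (‖q‖ * ‖d‖) := by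
          refine Finset.sum_le_sum fun t _ => (le_abs_self _).trans ?_
          rw [abs_mul]
          calc |⟪x t, q⟫| * |⟪x t, d⟫| ≤ (‖x t‖ * ‖q‖) * (‖x t‖ * ‖d‖) := by
                gcongr <;> exact abs_real_inner_le_norm _ _
            _ = _ := by ring
      _ = (∑ t ∈ I, ‖x t‖ ^ 2) * (‖q‖ * ‖d‖) := by rw [Finset.sum_mul]
      _ ≤ Q * (‖q‖ * ‖d‖) := by gcongr
      _ = _ := by ring
  have h3 : ⟪∑ t ∈ I, ε t • x t, d⟫ ≤ E * ‖d‖ :=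
    (real_inner_le_norm _ _).trans (by gcongr)
  have h4 : -(r * ⟪w, d⟫) ≤ r * (‖w‖ * ‖d‖) := by
    rw [← mul_neg]
    gcongr
    exact (neg_le_abs _).trans (abs_real_inner_le_norm _ _)
  have h5 : a * ‖d‖ * ‖d‖ ≤ (E + Q * ‖q‖ + r * ‖w‖) * ‖d‖ := by
    have := ha d
    have : 0 ≤ r * ‖d‖ ^ 2 := by positivity
    nlinarith
  rcases (norm_nonneg d).eq_or_lt with h0 | h0
  · rw [← h0]
    have : 0 ≤ Q * ‖q‖ := by positivity
    have : 0 ≤ r * ‖w‖ := by positivity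
    linarith
  · exact le_of_mul_le_mul_right h5 h0

/-- Testing the ridge equations against b itself bounds b with no eigenvalue condition, which serves
the steps with too few samples. -/
lemma mul_norm_sq_le_of_normal_eq {I : Finset ℕ} {x : ℕ → Vec (Fin p)} {y : ℕ → ℝ}
    {b : Vec (Fin p)} {r : ℝ}
    (hfit : ∑ t ∈ I, ⟪x t, b⟫ * ⟪x t, b⟫ + r * ⟪b, b⟫ = ∑ t ∈ I, y t * ⟪x t, b⟫) :
    r * ‖b‖ ^ 2 ≤ ∑ t ∈ I, y t ^ 2 := by
  rw [real_inner_self_eq_norm_sq] at hfit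
  have : ∑ t ∈ I, y t * ⟪x t, b⟫ ≤ ∑ t ∈ I, (y t ^ 2 + ⟪x t, b⟫ * ⟪x t, b⟫) :=
    Finset.sum_le_sum fun t _ => by
      nlinarith [sq_nonneg (y t - ⟪x t, b⟫), sq_nonneg (y t), sq_nonneg (⟪x t, b⟫)]
  rw [Finset.sum_add_distrib] at this
  linarith

lemma abs_apply_le_norm (v : Vec (Fin p)) (j : Fin p) : |v j| ≤ ‖v‖ := by
  simpa using PiLp.norm_apply_le v j

/-- Coefficients dropped by thresholding are at most twice the estimation error. -/
lemma IsTop.abs_le_of_notMem {b β : Vec (Fin p)} {S : Finset (Fin p)}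
    (h : IsTop (supp β).card b S) {j : Fin p} (hj : j ∉ S) : |β j| ≤ 2 * ‖b - β‖ := by
  by_cases hβ : β j = 0
  · rw [hβ, abs_zero]; positivity
  have hjs : j ∈ supp β := by simp [supp, hβ]
  -- Pigeonhole: S and the true support have the same size and j lies only in the latter, so S
  -- contains some l with β_l = 0. Then |b_j| ≤ |b_l| = |b_l - β_l|.
  obtain ⟨l, hlS, hl⟩ : ∃ l ∈ S, l ∉ supp β := by
    by_contra! hsub
    exact hj (Finset.eq_of_subset_of_card_le hsub h.1.ge ▸ hjs)
  have hl0 : β l = 0 := by simpa [supp] using hl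
  have h1 := h.2 l hlS j hj
  have h2 := abs_apply_le_norm (b - β) l
  have h3 := abs_apply_le_norm (b - β) j
  simp only [PiLp.sub_apply, hl0, sub_zero] at h2 h3
  have h4 : |β j| ≤ |b j| + |b j - β j| := by
    have := abs_sub_abs_le_abs_sub (β j) (b j)
    rw [abs_sub_comm] at this
    linarith
  linarith

/-- The vector `v` with the coordinates outside of `S` replaced by `0`. -/
def proj (S : Finset (Fin p)) (v : Vec (Fin p)) : Vec (Fin p) :=
  WithLp.toLp 2 fun j => if j ∈ S then v j else 0

lemma norm_proj_le (S : Finset (Fin p)) (v : Vec (Fin p)) : ‖proj S v‖ ≤ ‖v‖ := by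
  rw [← sq_le_sq₀ (norm_nonneg _) (norm_nonneg _), EuclideanSpace.real_norm_sq_eq,
    EuclideanSpace.real_norm_sq_eq]
  refine Finset.sum_le_sum fun j _ => ?_
  by_cases hj : j ∈ S <;> simp [proj, hj, sq_nonneg]

lemma norm_sub_proj_le {S : Finset (Fin p)} {v : Vec (Fin p)} {e : ℝ} (he : 0 ≤ e)
    (h : ∀ j ∉ S, |v j| ≤ e) : ‖v - proj S v‖ ≤ p * e := by
  rw [← sq_le_sq₀ (norm_nonneg _) (by positivity), EuclideanSpace.real_norm_sq_eq]
  have h1 : ∀ j ∈ Finset.univ, (v - proj S v) j ^ 2 ≤ e ^ 2 := fun j _ => by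
    by_cases hj : j ∈ S
    · simp [proj, hj, sq_nonneg]
    · simpa [proj, hj] using pow_le_pow_left₀ (abs_nonneg _) (h j hj) 2
  refine (Finset.sum_le_sum h1).trans ?_
  simp only [Finset.sum_const, Finset.card_univ, Fintype.card_fin, nsmul_eq_mul]
  rw [mul_pow]
  gcongr
  rcases Nat.eq_zero_or_pos p with rfl | hp
  · simp
  · have : (1 : ℝ) ≤ p := by exact_mod_cast hp
    nlinarith

/-- Estimation error of least squares with thresholding. -/
lemma IsLSthFit.norm_sub_le {x : ℕ → Vec (Fin p)} {ε : ℕ → ℝ} {b β : Vec (Fin p)}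
    {r a E Q : ℝ} {i : ℕ} (hr : 0 ≤ r) (ha0 : 0 < a)
    (ha : ∀ v, a * ‖v‖ ^ 2 ≤ ∑ t ∈ Finset.Ico 1 i, ⟪x t, v⟫ ^ 2)
    (hE : ‖∑ t ∈ Finset.Ico 1 i, ε t • x t‖ ≤ E) (hQ : ∑ t ∈ Finset.Ico 1 i, ‖x t‖ ^ 2 ≤ Q)
    (h : IsLSthFit x (fun t => ⟪x t, β⟫ + ε t) r (supp β).card i b) :
    ‖b - β‖ ≤ (1 + 2 * p + 2 * p * (Q / a)) * ((E + r * ‖β‖) / a) := by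
  obtain ⟨b₀, S, hfull, htop, hfit, hbS⟩ := h
  set e := (E + r * ‖β‖) / a with he
  have hQ0 : 0 ≤ Q := (Finset.sum_nonneg fun t _ => sq_nonneg _).trans hQ
  have h0 : ‖b₀ - β‖ ≤ e := by
    have := mul_norm_sub_le_of_normal_eq hr ha hE hQ (hfull.inner_eq (b₀ - β))
    rw [he, le_div_iff₀ ha0]
    simp only [sub_self, norm_zero, mul_zero, add_zero] at this
    linarith
  have he0 : 0 ≤ e := (norm_nonneg _).trans h0
  -- The refit is compared with `proj S β`, which lies in the fitted subspace; the discarded part of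
  -- β enters as a misfit of order e.
  have hq : ‖β - proj S β‖ ≤ p * (2 * e) := norm_sub_proj_le (by positivity) fun j hj =>
    (htop.abs_le_of_notMem hj).trans (by gcongr)
  have hsupp : ∀ j ∉ S, (b - proj S β) j = 0 := fun j hj => by simp [proj, hj, hbS j hj]
  have h1 := mul_norm_sub_le_of_normal_eq hr ha hE hQ (hfit.inner_eq_of_restrictTo hbS hsupp)
  have h2 : ‖b - proj S β‖ ≤ e + Q / a * (p * (2 * e)) := by
    have h3 : a * ‖b - proj S β‖ ≤ a * (e + Q / a * (p * (2 * e))) := by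
      calc a * ‖b - proj S β‖ ≤ E + Q * (p * (2 * e)) + r * ‖β‖ := by
            refine h1.trans ?_
            gcongr
            exact norm_proj_le S β
        _ = _ := by rw [he]; field_simp; ring
    exact le_of_mul_le_mul_left h3 ha0
  calc ‖b - β‖ = ‖(b - proj S β) - (β - proj S β)‖ := by congr 1; abel
    _ ≤ ‖b - proj S β‖ + ‖β - proj S β‖ := _root_.norm_sub_le _ _
    _ ≤ _ := by linarith

lemma IsLSthFit.mul_norm_sq_le {x : ℕ → Vec (Fin p)} {y : ℕ → ℝ} {b : Vec (Fin p)}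
    {r : ℝ} {k i : ℕ} (h : IsLSthFit x y r k i b) :
    r * ‖b‖ ^ 2 ≤ ∑ t ∈ Finset.Ico 1 i, y t ^ 2 := by
  obtain ⟨b₀, S, hfull, htop, hfit, hbS⟩ := h
  exact mul_norm_sq_le_of_normal_eq (hfit.inner_eq_of_restrictTo hbS hbS)

end LeastSquares

/-! ### Regret bound on regular data. -/

section Regret

variable {p : ℕ}

/-- The bounds on the data `x_t, ε_t` (`t ≤ n`) which hold with high probability. -/
structure IsRegular (x : ℕ → Vec (Fin p)) (ε : ℕ → ℝ) (n : ℕ) (c A L : ℝ) : Prop where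
  eig : ∀ N : ℕ, p ≤ N → L ≤ N → N ≤ n →
    ∀ v, c * N * ‖v‖ ^ 2 ≤ ∑ t ∈ Finset.Icc 1 N, ⟪x t, v⟫ ^ 2
  sum_norm : ∀ N : ℕ, N ≤ n → ∑ t ∈ Finset.Icc 1 N, ‖x t‖ ^ 2 ≤ A * (N + L)
  sum_eps : ∀ N : ℕ, N ≤ n → ∑ t ∈ Finset.Icc 1 N, ε t ^ 2 ≤ A * (N + L)
  sum_norm_div : ∑ t ∈ Finset.Icc 1 n, 1 / (t : ℝ) * ‖x t‖ ^ 2 ≤ A * L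
  noise : ∀ N : ℕ, L ≤ N → N ≤ n → ‖∑ t ∈ Finset.Icc 1 N, ε t • x t‖ ≤ A * √(N * L)

lemma Ico_one_eq_Icc {i : ℕ} (hi : 1 ≤ i) : Finset.Ico 1 i = Finset.Icc 1 (i - 1) := by
  ext t; simp only [Finset.mem_Ico, Finset.mem_Icc]; omega

/-- Noise of size √(NL) divided by an eigenvalue of order N, where N = i - 1. It covers ridge as
well as OLS, since the bias r‖β‖ is absorbed by √(NL) ≥ 1. -/
lemma IsRegular.norm_sub_sq_le_late {x : ℕ → Vec (Fin p)} {ε : ℕ → ℝ} {n : ℕ} {c A L : ℝ}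
    (h : IsRegular x ε n c A L) (hp : 1 ≤ p) (hc : 0 < c) (hA : 0 < A) (hL : 1 ≤ L)
    {r r' B : ℝ} (hr' : 0 ≤ r') (hrr : r' ≤ r) {β b : Vec (Fin p)} (hβ : ‖β‖ ≤ B) {i : ℕ}
    (hi : i ≤ n) (hpi : p ≤ i - 1) (hLi : L ≤ (i - 1 : ℕ))
    (hb : IsLSthFit x (fun t => ⟪x t, β⟫ + ε t) r' (supp β).card i b) :
    ‖b - β‖ ^ 2 ≤ 2 * ((1 + 2 * p + 2 * p * (2 * A / c)) * (A + r * B) / c) ^ 2 * (L * (1 / i)) := by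
  obtain ⟨N, rfl⟩ : ∃ N, i = N + 1 := ⟨i - 1, by omega⟩
  simp only [Nat.add_sub_cancel] at hpi hLi
  have hN : (1 : ℝ) ≤ N := hL.trans hLi
  have hB : 0 ≤ B := (norm_nonneg _).trans hβ
  have hI : Finset.Ico 1 (N + 1) = Finset.Icc 1 N := by
    rw [Ico_one_eq_Icc (by omega)]; simp
  have hQ : ∑ t ∈ Finset.Ico 1 (N + 1), ‖x t‖ ^ 2 ≤ 2 * A * N := by
    rw [hI]
    refine (h.sum_norm N (by omega)).trans ?_
    nlinarith
  have hE := h.noise N hLi (by omega)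
  rw [← hI] at hE
  have ha := h.eig N hpi hLi (by omega)
  rw [← hI] at ha
  have h1 := hb.norm_sub_le hr' (by positivity) ha hE hQ
  have hs : 1 ≤ √(N * L) := by
    rw [Real.one_le_sqrt]; nlinarith
  have h2 : A * √(N * L) + r' * ‖β‖ ≤ (A + r * B) * √(N * L) := by
    have : r' * ‖β‖ ≤ r * B := mul_le_mul hrr hβ (norm_nonneg _) (hr'.trans hrr)
    nlinarith [mul_nonneg (hr'.trans hrr) hB]
  have h3 : ‖b - β‖ ≤ ((1 + 2 * p + 2 * p * (2 * A / c)) * (A + r * B) / c) * (√(N * L) / N) := by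
    refine h1.trans ?_
    have h4 : 2 * A * N / (c * N) = 2 * A / c := by field_simp
    rw [h4]
    calc _ ≤ (1 + 2 * p + 2 * p * (2 * A / c)) * ((A + r * B) * √(N * L) / (c * N)) := by gcongr
      _ = _ := by field_simp
  have h5 : (√(N * L) / N) ^ 2 ≤ 2 * (L * (1 / (N + 1 : ℕ))) := by
    rw [div_pow, Real.sq_sqrt (by positivity)]
    have h6 : (N : ℝ) * L / N ^ 2 = L / N := by field_simp
    rw [h6, mul_one_div, ← mul_div_assoc, div_le_div_iff₀ (by positivity) (by positivity)]
    push_cast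
    nlinarith
  calc ‖b - β‖ ^ 2 ≤ (((1 + 2 * p + 2 * p * (2 * A / c)) * (A + r * B) / c)
        * (√(N * L) / N)) ^ 2 := by gcongr
    _ = ((1 + 2 * p + 2 * p * (2 * A / c)) * (A + r * B) / c) ^ 2 * (√(N * L) / N) ^ 2 := by
        rw [mul_pow]
    _ ≤ ((1 + 2 * p + 2 * p * (2 * A / c)) * (A + r * B) / c) ^ 2 *
        (2 * (L * (1 / (N + 1 : ℕ)))) := by gcongr
    _ = _ := by ring

lemma IsRegular.norm_sub_sq_le_early {x : ℕ → Vec (Fin p)} {ε : ℕ → ℝ} {n : ℕ} {c A L : ℝ}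
    (h : IsRegular x ε n c A L) (hA : 0 < A) (hL : 1 ≤ L)
    {r B : ℝ} (hr : 0 < r) {β b : Vec (Fin p)} (hβ : ‖β‖ ≤ B) {i : ℕ} (hi1 : 1 ≤ i)
    (hi : i ≤ n) (hpi : ((i - 1 : ℕ) : ℝ) ≤ p + L)
    (hb : IsLSthFit x (fun t => ⟪x t, β⟫ + ε t) r (supp β).card i b) :
    ‖b - β‖ ^ 2 ≤ (4 * A * (B ^ 2 + 1) * (p + 2) / r + 2 * B ^ 2) * L := by
  have h1 := hb.mul_norm_sq_le
  rw [Ico_one_eq_Icc hi1] at h1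
  have hB : 0 ≤ B := (norm_nonneg _).trans hβ
  set N := i - 1
  have h2 : ∑ t ∈ Finset.Icc 1 N, (⟪x t, β⟫ + ε t) ^ 2 ≤ 2 * A * (B ^ 2 + 1) * (p + 2) * L := by
    calc ∑ t ∈ Finset.Icc 1 N, (⟪x t, β⟫ + ε t) ^ 2
        ≤ ∑ t ∈ Finset.Icc 1 N, (2 * B ^ 2 * ‖x t‖ ^ 2 + 2 * ε t ^ 2) := by
          refine Finset.sum_le_sum fun t _ => ?_
          have h3 : ⟪x t, β⟫ ^ 2 ≤ (‖x t‖ * B) ^ 2 := by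
            rw [← sq_abs]
            gcongr
            exact (abs_real_inner_le_norm _ _).trans (by gcongr)
          nlinarith [sq_nonneg (⟪x t, β⟫ - ε t)]
      _ = 2 * B ^ 2 * ∑ t ∈ Finset.Icc 1 N, ‖x t‖ ^ 2 + 2 * ∑ t ∈ Finset.Icc 1 N, ε t ^ 2 := by
          rw [Finset.sum_add_distrib, Finset.mul_sum, Finset.mul_sum]
      _ ≤ 2 * B ^ 2 * (A * (N + L)) + 2 * (A * (N + L)) := by
          gcongr
          · exact h.sum_norm N (by omega)
          · exact h.sum_eps N (by omega)
      _ = 2 * A * (B ^ 2 + 1) * (N + L) := by ring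
      _ ≤ 2 * A * (B ^ 2 + 1) * ((p + 2) * L) := by
          gcongr
          nlinarith [Nat.cast_nonneg (α := ℝ) p]
      _ = _ := by ring
  have h3 : ‖b‖ ^ 2 ≤ 2 * A * (B ^ 2 + 1) * (p + 2) / r * L := by
    rw [div_mul_eq_mul_div, le_div_iff₀ hr]
    linarith
  have h4 : ‖b - β‖ ^ 2 ≤ 2 * ‖b‖ ^ 2 + 2 * B ^ 2 := by
    have h5 : ‖b - β‖ ^ 2 ≤ (‖b‖ + B) ^ 2 := by
      gcongr
      exact (_root_.norm_sub_le _ _).trans (by gcongr)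
    nlinarith [sq_nonneg (‖b‖ - B)]
  have h6 : 2 * B ^ 2 ≤ 2 * B ^ 2 * L := le_mul_of_one_le_right (by positivity) hL
  calc _ ≤ 2 * ‖b‖ ^ 2 + 2 * B ^ 2 := h4
    _ ≤ 2 * (2 * A * (B ^ 2 + 1) * (p + 2) / r * L) + 2 * B ^ 2 * L := by gcongr
    _ = _ := by ring

/-- The empirical risk of any fixed vector is almost at least that of the true coefficients. -/
lemma IsRegular.sum_sqLoss_ge {x : ℕ → Vec (Fin p)} {ε : ℕ → ℝ} {n : ℕ} {c A L : ℝ}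
    (h : IsRegular x ε n c A L) (hc : 0 < c) (hn : 0 < n) (hpn : p ≤ n)
    (hL0 : 0 ≤ L) (hLn : L ≤ n) (β v : Vec (Fin p)) :
    ∑ t ∈ Finset.Icc 1 n, ε t ^ 2 - A ^ 2 / c * L ≤
      ∑ t ∈ Finset.Icc 1 n, sqLoss v (x t) (⟪x t, β⟫ + ε t) := by
  have hn' : (0 : ℝ) < n := by exact_mod_cast hn
  set d := v - β with hd
  have h1 : ∑ t ∈ Finset.Icc 1 n, sqLoss v (x t) (⟪x t, β⟫ + ε t) =
      ∑ t ∈ Finset.Icc 1 n, ε t ^ 2 - 2 * ⟪∑ t ∈ Finset.Icc 1 n, ε t • x t, d⟫ +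
        ∑ t ∈ Finset.Icc 1 n, ⟪x t, d⟫ ^ 2 := by
    rw [sum_inner, Finset.mul_sum, ← Finset.sum_sub_distrib, ← Finset.sum_add_distrib]
    refine Finset.sum_congr rfl fun t _ => ?_
    simp only [sqLoss, hd, inner_sub_right, real_inner_smul_left]
    ring
  have h2 : ⟪∑ t ∈ Finset.Icc 1 n, ε t • x t, d⟫ ≤ A * √(n * L) * ‖d‖ :=
    (real_inner_le_norm _ _).trans (by gcongr; exact h.noise n hLn le_rfl)
  have h3 := h.eig n hpn hLn le_rfl d
  -- AM-GM: the quadratic growth c n ‖d‖² absorbs the noise term up to A²L/c.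
  have h4 : 2 * (A * √(n * L) * ‖d‖) ≤ c * n * ‖d‖ ^ 2 + A ^ 2 / c * L := by
    have h5 : A ^ 2 / c * L * (c * n) = (A * √(n * L)) ^ 2 := by
      rw [mul_pow, Real.sq_sqrt (by positivity)]
      field_simp
    have hcn : 0 < c * n := by positivity
    have h6 := sq_nonneg (c * n * ‖d‖ - A * √(n * L))
    refine le_of_mul_le_mul_right ?_ hcn
    rw [add_mul, h5]
    nlinarith
  rw [h1]
  linarith

/-- Deterministic regret bound on regular data. -/
lemma exists_regret_le (p : ℕ) (hp : 1 ≤ p) {c A r B : ℝ} (hc : 0 < c) (hA : 0 < A) (hr : 0 < r) :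
    ∃ C : ℝ, 0 < C ∧ ∀ (x : ℕ → Vec (Fin p)) (ε : ℕ → ℝ) (n : ℕ) (L : ℝ),
      IsRegular x ε n c A L → p ≤ n → 1 ≤ L → L ≤ n → ∀ β : Vec (Fin p), ‖β‖ ≤ B →
      ∀ b : ℕ → Vec (Fin p),
      (∀ i, 1 ≤ i → i ≤ n → ∃ r', 0 ≤ r' ∧ r' ≤ r ∧
        (i - 1 < p ∨ ((i - 1 : ℕ) : ℝ) < L → r' = r) ∧
        IsLSthFit x (fun t => ⟪x t, β⟫ + ε t) r' (supp β).card i (b i)) →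
      ∑ i ∈ Finset.Icc 1 n, ε i * ⟪x i, β - b i⟫ ≤
        1 / 2 * ∑ i ∈ Finset.Icc 1 n, ⟪x i, β - b i⟫ ^ 2 + A * L →
      regret x (fun t => ⟪x t, β⟫ + ε t) (supp β).card n b ≤ C * (L ^ 2 / n) := by
  set D₁ := 2 * ((1 + 2 * p + 2 * p * (2 * A / c)) * (A + r * B) / c) ^ 2 with hD₁
  set D₂ := 4 * A * (B ^ 2 + 1) * (p + 2) / r + 2 * B ^ 2 with hD₂
  have hD₁0 : 0 ≤ D₁ := by positivity
  have hD₂0 : 0 ≤ D₂ := by positivity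
  set D := D₁ + D₂ with hD
  have hD0 : 0 ≤ D := by positivity
  refine ⟨2 * (D * A * (p + 4)) + 2 * A + A ^ 2 / c, by positivity, ?_⟩
  intro x ε n L h hpn hL hLn β hβ b hb hmart
  have hn : 0 < n := by omega
  have hn' : (0 : ℝ) < n := by exact_mod_cast hn
  set N' := min n ⌊(p : ℝ) + L + 1⌋₊ with hN'
  have herr : ∀ i ∈ Finset.Icc 1 n, ‖b i - β‖ ^ 2 ≤
      D * L * (1 / i) + if i ≤ N' then D * L else 0 := fun i hi => by
    rw [Finset.mem_Icc] at hi
    obtain ⟨r', hr'0, hr'r, hearly, hfit⟩ := hb i hi.1 hi.2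
    have hi0 : (0 : ℝ) < i := by exact_mod_cast hi.1
    -- The split is at max(p, L), not at n₀: ridge steps between the two are treated as late.
    by_cases hcase : i - 1 < p ∨ ((i - 1 : ℕ) : ℝ) < L
    · rw [hearly hcase] at hfit
      have hle : ((i - 1 : ℕ) : ℝ) ≤ p + L := by
        rcases hcase with h1 | h1
        · have : ((i - 1 : ℕ) : ℝ) < p := by exact_mod_cast h1
          linarith
        · linarith [Nat.cast_nonneg (α := ℝ) p]
      have hiN : i ≤ N' := by
        refine le_min hi.2 (Nat.le_floor ?_)
        rw [Nat.cast_sub hi.1] at hle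
        push_cast at hle
        linarith
      have := h.norm_sub_sq_le_early hA hL hr hβ hi.1 hi.2 hle hfit
      rw [if_pos hiN]
      have h1 : D₂ * L ≤ D * L := by gcongr; linarith
      have h2 : 0 ≤ D * L * (1 / i) := by positivity
      linarith
    · push Not at hcase
      have := h.norm_sub_sq_le_late hp hc hA hL hr'0 hr'r hβ hi.2 hcase.1 hcase.2 hfit
      have h1 : D₁ * (L * (1 / i)) ≤ D * L * (1 / i) := by
        rw [← mul_assoc]; gcongr; linarith
      have h2 : (0 : ℝ) ≤ if i ≤ N' then D * L else 0 := by split_ifs <;> positivity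
      linarith
  -- The 1/i part costs DL · AL by `sum_norm_div`; the extra DL on the first N' = O(L) steps costs
  -- DL · A(N' + L).
  have hV : ∑ i ∈ Finset.Icc 1 n, ⟪x i, β - b i⟫ ^ 2 ≤ D * A * (p + 4) * L ^ 2 := by
    have h1 : ∀ i ∈ Finset.Icc 1 n, ⟪x i, β - b i⟫ ^ 2 ≤
        D * L * (1 / i * ‖x i‖ ^ 2) + if i ≤ N' then D * L * ‖x i‖ ^ 2 else 0 := fun i hi => by
      have h2 : ⟪x i, β - b i⟫ ^ 2 ≤ (‖x i‖ * ‖b i - β‖) ^ 2 := by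
        rw [← sq_abs, norm_sub_rev]
        gcongr
        exact abs_real_inner_le_norm _ _
      have h3 := mul_le_mul_of_nonneg_left (herr i hi) (sq_nonneg ‖x i‖)
      refine h2.trans ?_
      rw [mul_pow]
      refine h3.trans (le_of_eq ?_)
      split_ifs <;> ring
    have h2 : ∑ i ∈ Finset.Icc 1 n, (if i ≤ N' then D * L * ‖x i‖ ^ 2 else 0) =
        D * L * ∑ i ∈ Finset.Icc 1 N', ‖x i‖ ^ 2 := by
      rw [← Finset.sum_filter, Finset.mul_sum]
      refine Finset.sum_congr ?_ fun _ _ => rfl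
      ext i
      simp only [Finset.mem_filter, Finset.mem_Icc]
      have : N' ≤ n := min_le_left _ _
      omega
    have hN'L : (N' : ℝ) ≤ p + L + 1 :=
      (Nat.cast_le.2 (min_le_right _ _)).trans (Nat.floor_le (by positivity))
    calc ∑ i ∈ Finset.Icc 1 n, ⟪x i, β - b i⟫ ^ 2
        ≤ D * L * ∑ i ∈ Finset.Icc 1 n, 1 / (i : ℝ) * ‖x i‖ ^ 2 +
          D * L * ∑ i ∈ Finset.Icc 1 N', ‖x i‖ ^ 2 := by
          rw [← h2, Finset.mul_sum, ← Finset.sum_add_distrib]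
          exact Finset.sum_le_sum h1
      _ ≤ D * L * (A * L) + D * L * (A * (N' + L)) := by
          gcongr
          · exact h.sum_norm_div
          · exact h.sum_norm N' (min_le_left _ _)
      _ ≤ D * L * (A * L) + D * L * (A * ((p + 3) * L)) := by
          gcongr
          nlinarith [Nat.cast_nonneg (α := ℝ) p]
      _ = _ := by ring
  have hinf : 1 / (n : ℝ) * (∑ t ∈ Finset.Icc 1 n, ε t ^ 2 - A ^ 2 / c * L) ≤
      ⨅ v : {v : Vec (Fin p) // (supp v).card ≤ (supp β).card},
        1 / (n : ℝ) * ∑ i ∈ Finset.Icc 1 n, sqLoss v.1 (x i) (⟪x i, β⟫ + ε i) := by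
    have : Nonempty {v : Vec (Fin p) // (supp v).card ≤ (supp β).card} := ⟨⟨β, le_rfl⟩⟩
    refine le_ciInf fun v => ?_
    gcongr
    exact h.sum_sqLoss_ge hc hn hpn (by positivity) hLn β v.1
  have hloss : ∑ i ∈ Finset.Icc 1 n, sqLoss (b i) (x i) (⟪x i, β⟫ + ε i) =
      ∑ i ∈ Finset.Icc 1 n, ε i ^ 2 + 2 * ∑ i ∈ Finset.Icc 1 n, ε i * ⟪x i, β - b i⟫ +
        ∑ i ∈ Finset.Icc 1 n, ⟪x i, β - b i⟫ ^ 2 := by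
    rw [Finset.mul_sum, ← Finset.sum_add_distrib, ← Finset.sum_add_distrib]
    refine Finset.sum_congr rfl fun t _ => ?_
    rw [sqLoss, inner_sub_right]
    ring
  have hLL : L ≤ L ^ 2 := by nlinarith
  have hfin : ∑ i ∈ Finset.Icc 1 n, sqLoss (b i) (x i) (⟪x i, β⟫ + ε i) -
      (∑ t ∈ Finset.Icc 1 n, ε t ^ 2 - A ^ 2 / c * L) ≤
      (2 * (D * A * (p + 4)) + 2 * A + A ^ 2 / c) * L ^ 2 := by
    have h1 : (2 * A + A ^ 2 / c) * L ≤ (2 * A + A ^ 2 / c) * L ^ 2 := by gcongr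
    rw [hloss]
    nlinarith
  calc regret x (fun t => ⟪x t, β⟫ + ε t) (supp β).card n b
      ≤ 1 / (n : ℝ) * (∑ i ∈ Finset.Icc 1 n, sqLoss (b i) (x i) (⟪x i, β⟫ + ε i) -
        (∑ t ∈ Finset.Icc 1 n, ε t ^ 2 - A ^ 2 / c * L)) := by
        rw [regret, mul_sub]
        linarith
    _ ≤ 1 / (n : ℝ) * ((2 * (D * A * (p + 4)) + 2 * A + A ^ 2 / c) * L ^ 2) := by gcongr
    _ = _ := by ring

end Regret

end OLSth

namespace OLSth

/-! ### Regularity with probability at least 1 - 3/n. -/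

section HighProbability

variable {p : ℕ} {Sig : Matrix (Fin p) (Fin p) ℝ} {σ : ℝ}

lemma norm_le_sum_abs (v : Vec (Fin p)) : ‖v‖ ≤ ∑ j, |v j| := by
  rw [← sq_le_sq₀ (norm_nonneg _) (Finset.sum_nonneg fun j _ => abs_nonneg _),
    EuclideanSpace.real_norm_sq_eq]
  simpa using Finset.sum_sq_le_sq_sum_of_nonneg (s := Finset.univ) (f := fun j => |v j|)
    fun j _ => abs_nonneg _

/-- Reduces the vector noise to 2p scalar sums, in the directions ±e_j. -/
lemma norm_sum_le_of_inner_lt {I : Finset ℕ} {x : ℕ → Vec (Fin p)} {ε : ℕ → ℝ} {a : ℝ}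
    (h : ∀ j, ∀ s ∈ ({1, -1} : Finset ℝ),
      ∑ t ∈ I, ε t * ⟪x t, s • EuclideanSpace.single j (1 : ℝ)⟫ ≤ a) :
    ‖∑ t ∈ I, ε t • x t‖ ≤ p * a := by
  refine (norm_le_sum_abs _).trans ?_
  calc ∑ j, |(∑ t ∈ I, ε t • x t) j| ≤ ∑ _j : Fin p, a := by
        refine Finset.sum_le_sum fun j _ => abs_le'.2 ⟨?_, ?_⟩
        · simpa [EuclideanSpace.inner_single_right] using h j 1 (by simp)
        · simpa [EuclideanSpace.inner_single_right] using h j (-1) (by simp)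
    _ = p * a := by simp

lemma sum_one_div_le {n : ℕ} (hn : 1 ≤ Real.log n) :
    ∑ t ∈ Finset.Icc 1 n, 1 / (t : ℝ) ≤ 2 * Real.log n := by
  have h := harmonic_le_one_add_log n
  rw [harmonic_eq_sum_Icc] at h
  push_cast at h
  simp only [one_div]
  linarith

/-- Outside of an event of probability `3 / n` the data are regular and the noise term of the
regret is controlled. -/
lemma exists_measure_not_isRegular_le (hp : 1 ≤ p) (hSig : Sig.PosDef) (hσ : 0 < σ) :
    ∃ c A : ℝ, 0 < c ∧ 0 < A ∧ ∀ (Ω : Type*) [MeasurableSpace Ω] (P : Measure Ω)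
      [IsProbabilityMeasure P] (x : ℕ → Ω → Vec (Fin p)) (ε : ℕ → Ω → ℝ),
      IsGaussianStream P Sig σ x ε → ∀ n : ℕ, p < n → 3 ≤ n → ∀ a : ℕ → Ω → Vec (Fin p),
      (∀ i, 1 ≤ i → i ≤ n → Measurable[past x ε i] (a i)) →
      P {ω | ¬ (IsRegular (fun i => x i ω) (fun i => ε i ω) n c A (Real.log n) ∧
        ∑ i ∈ Finset.Icc 1 n, ε i ω * ⟪x i ω, a i ω⟫ ≤
          1 / 2 * ∑ i ∈ Finset.Icc 1 n, ⟪x i ω, a i ω⟫ ^ 2 + A * Real.log n)} ≤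
        ENNReal.ofReal (3 / n) := by
  obtain ⟨c, hc, hbad₁⟩ := exists_measure_not_eigenvalue_bound_le hp hSig (T := 6) (by norm_num) σ
  obtain ⟨A₁, hA₁, hbad₂⟩ := exists_measure_weighted_sum_norm_sq_ge_le
    (multivariateGaussian (0 : Vec (Fin p)) Sig)
  obtain ⟨A₂, hA₂, hbad₃⟩ := exists_measure_weighted_sum_norm_sq_ge_le
    (gaussianReal 0 (σ ^ 2).toNNReal)
  refine ⟨c, 8 * A₁ + 6 * A₂ + p * (6 * σ ^ 2 * A₁ + 6) + 6 * σ ^ 2, hc, by positivity, ?_⟩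
  intro Ω _ P _ x ε h n hpn hn a ha
  set A := 8 * A₁ + 6 * A₂ + p * (6 * σ ^ 2 * A₁ + 6) + 6 * σ ^ 2 with hA
  have hσA : 0 ≤ p * (6 * σ ^ 2 * A₁ + 6) := by positivity
  have hσ2 : 0 ≤ σ ^ 2 := by positivity
  set L := Real.log n with hLdef
  have hn' : (3 : ℝ) ≤ n := by exact_mod_cast hn
  have hL : 1 ≤ L := by
    rw [hLdef, Real.le_log_iff_exp_le (by linarith)]
    linarith [Real.exp_one_lt_three]
  -- Every bad event has probability at most q = n⁻⁶. There are (n+1)(3+2p) + 2 ≤ 4n² of them, as p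
  -- < n and n ≥ 3, and 4n² · n⁻⁶ ≤ 3/n.
  set q := ENNReal.ofReal (Real.exp (-(6 * L))) with hq
  -- This choice balances lN against L/l, both equal to √(NL). At N = 0 the quotient is 0, so l = 0;
  -- hence the clause 0 < l N in `B₅`.
  let l : ℕ → ℝ := fun N => √(L / N)
  let B₁ : ℕ → Set Ω := fun N => {ω | p ≤ N ∧ L ≤ N ∧
    ¬ ∀ v, c * N * ‖v‖ ^ 2 ≤ ∑ t ∈ Finset.Icc 1 N, ⟪x t ω, v⟫ ^ 2}
  let B₂ : ℕ → Set Ω := fun N => {ω | A₁ * (∑ _t ∈ Finset.Icc 1 N, (1 : ℝ) + 6 * L) ≤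
    ∑ t ∈ Finset.Icc 1 N, 1 * ‖x t ω‖ ^ 2}
  let B₃ : ℕ → Set Ω := fun N => {ω | A₂ * (∑ _t ∈ Finset.Icc 1 N, (1 : ℝ) + 6 * L) ≤
    ∑ t ∈ Finset.Icc 1 N, 1 * ‖ε t ω‖ ^ 2}
  let B₄ : Set Ω := {ω | A₁ * (∑ t ∈ Finset.Icc 1 n, 1 / (t : ℝ) + 6 * L) ≤
    ∑ t ∈ Finset.Icc 1 n, 1 / (t : ℝ) * ‖x t ω‖ ^ 2}
  let B₅ : ℕ → Fin p → ℝ → Set Ω := fun N j s => {ω | 0 < l N ∧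
    l N * σ ^ 2 / 2 * ∑ t ∈ Finset.Icc 1 N, ⟪x t ω, s • EuclideanSpace.single j (1 : ℝ)⟫ ^ 2 +
      6 * L / l N ≤
    ∑ t ∈ Finset.Icc 1 N, ε t ω * ⟪x t ω, s • EuclideanSpace.single j (1 : ℝ)⟫}
  -- Taking l = 1/σ² makes the coefficient of the quadratic term exactly 1/2.
  let B₆ : Set Ω := {ω | 1 / σ ^ 2 * σ ^ 2 / 2 * ∑ i ∈ Finset.Icc 1 n, ⟪x i ω, a i ω⟫ ^ 2 +
    6 * L / (1 / σ ^ 2) ≤ ∑ i ∈ Finset.Icc 1 n, ε i ω * ⟪x i ω, a i ω⟫}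
  have hB₁ : ∀ N, P (B₁ N) ≤ q := fun N => by
    by_cases hN : p ≤ N ∧ L ≤ N
    · refine (measure_mono fun ω hω => hω.2.2).trans ((hbad₁ Ω P x ε h N hN.1).trans ?_)
      refine ENNReal.ofReal_le_ofReal (Real.exp_le_exp.2 ?_)
      linarith [hN.2]
    · have : B₁ N = ∅ := Set.eq_empty_of_forall_notMem fun ω hω => hN ⟨hω.1, hω.2.1⟩
      rw [this]; simp
  have hB₂ : ∀ N, P (B₂ N) ≤ q := fun N =>
    hbad₂ Ω P x h.iIndepFun_x h.measurable_x h.map_x _ (fun _ => 1) (by simp) _ (by positivity)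
  have hB₃ : ∀ N, P (B₃ N) ≤ q := fun N =>
    hbad₃ Ω P ε h.iIndepFun_eps h.measurable_eps h.map_eps _ (fun _ => 1) (by simp) _
      (by positivity)
  have hB₄ : P B₄ ≤ q :=
    hbad₂ Ω P x h.iIndepFun_x h.measurable_x h.map_x _ (fun t => 1 / (t : ℝ))
      -- At t = 0 the weight 1/t is 0, so the bounds hold for every index.
      (fun t => ⟨by positivity, by simpa using Nat.cast_inv_le_one (α := ℝ) t⟩) _ (by positivity)
  have hB₅ : ∀ N j s, P (B₅ N j s) ≤ q := fun N j s => by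
    by_cases hl : 0 < l N
    · exact (measure_mono fun ω hω => hω.2).trans
        (h.measure_sum_ge_le (c := fun _ _ => s • EuclideanSpace.single j (1 : ℝ)) N
          (fun i _ _ => measurable_const) hl (6 * L))
    · have : B₅ N j s = ∅ := Set.eq_empty_of_forall_notMem fun ω hω => hl hω.1
      rw [this]; simp
  have hB₆ : P B₆ ≤ q := h.measure_sum_ge_le n ha (by positivity) (6 * L)
  let U : ℕ → Set Ω := fun N => B₁ N ∪ B₂ N ∪ B₃ N ∪
    ⋃ js ∈ (Finset.univ : Finset (Fin p)) ×ˢ ({1, -1} : Finset ℝ), B₅ N js.1 js.2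
  have hU : ∀ N, P (U N) ≤ (3 + p * 2) * q := fun N => by
    have h5 : P (⋃ js ∈ (Finset.univ : Finset (Fin p)) ×ˢ ({1, -1} : Finset ℝ),
        B₅ N js.1 js.2) ≤ p * 2 * q := by
      refine (measure_biUnion_finset_le _ _).trans
        ((Finset.sum_le_sum fun js _ => hB₅ N js.1 js.2).trans ?_)
      have hcard : ({1, -1} : Finset ℝ).card = 2 := Finset.card_pair (by norm_num)
      rw [Finset.sum_const, Finset.card_product, hcard, nsmul_eq_mul]
      simp
    calc P (U N) ≤ q + q + q + p * 2 * q := by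
          refine (measure_union_le _ _).trans (add_le_add ?_ h5)
          refine (measure_union_le _ _).trans (add_le_add ?_ (hB₃ N))
          exact (measure_union_le _ _).trans (add_le_add (hB₁ N) (hB₂ N))
      _ = _ := by ring
  have htotal : P (B₄ ∪ B₆ ∪ ⋃ N ∈ Finset.range (n + 1), U N) ≤ ENNReal.ofReal (3 / n) := by
    have h1 : P (⋃ N ∈ Finset.range (n + 1), U N) ≤ (n + 1) * ((3 + p * 2) * q) := by
      refine (measure_biUnion_finset_le _ _).trans ((Finset.sum_le_sum fun N _ => hU N).trans ?_)
      simp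
    have h2 : P (B₄ ∪ B₆ ∪ ⋃ N ∈ Finset.range (n + 1), U N) ≤
        (((n + 1) * (3 + p * 2) + 2 : ℕ) : ENNReal) * q := by
      calc _ ≤ q + q + (n + 1) * ((3 + p * 2) * q) := by
            refine (measure_union_le _ _).trans (add_le_add ?_ h1)
            exact (measure_union_le _ _).trans (add_le_add hB₄ hB₆)
        _ = _ := by push_cast; ring
    refine h2.trans ?_
    rw [hq, ← ENNReal.ofReal_natCast, ← ENNReal.ofReal_mul (Nat.cast_nonneg _)]
    refine ENNReal.ofReal_le_ofReal ?_
    have hexp : Real.exp (-(6 * L)) = 1 / (n : ℝ) ^ 6 := by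
      rw [Real.exp_neg, show (6 : ℝ) * L = ((6 : ℕ) : ℝ) * L by norm_num, Real.exp_nat_mul,
        hLdef, Real.exp_log (by linarith), one_div]
    have hpn' : (p : ℝ) ≤ n - 1 := by
      have : (p : ℝ) + 1 ≤ n := by exact_mod_cast hpn
      linarith
    rw [hexp, mul_one_div, div_le_div_iff₀ (by positivity) (by linarith)]
    push_cast
    have h3 : ((n : ℝ) + 1) * (3 + p * 2) + 2 ≤ 4 * n ^ 2 := by nlinarith
    calc (((n : ℝ) + 1) * (3 + p * 2) + 2) * n ≤ 4 * n ^ 2 * n := by gcongr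
      _ = 4 * (n ^ 3 * 1) := by ring
      _ ≤ 3 * (n ^ 3 * n ^ 3) := by
          have h4 : (27 : ℝ) ≤ n ^ 3 := by
            calc (27 : ℝ) = 3 ^ 3 := by norm_num
              _ ≤ _ := by gcongr
          nlinarith
      _ = 3 * n ^ 6 := by ring
  refine (measure_mono fun ω hω => ?_).trans htotal
  by_contra hgood
  refine hω ?_
  simp only [Set.mem_union, Set.mem_iUnion, not_or, not_exists] at hgood
  obtain ⟨⟨hg₄, hg₆⟩, hgU⟩ := hgood
  have hg : ∀ N ≤ n, ω ∉ U N := fun N hN => hgU N (Finset.mem_range.2 (by omega))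
  have hx : ∀ N ≤ n, ∑ t ∈ Finset.Icc 1 N, ‖x t ω‖ ^ 2 ≤ 6 * A₁ * (N + L) := fun N hN => by
    have h1 : ω ∉ B₂ N := fun h1 => hg N hN (Or.inl (Or.inl (Or.inr h1)))
    simp only [B₂, Set.mem_ofPred_eq, not_le, one_mul, Finset.sum_const, Nat.card_Icc,
      nsmul_eq_mul, mul_one, Nat.add_sub_cancel] at h1
    have : 0 ≤ A₁ * (N : ℝ) := by positivity
    nlinarith
  refine ⟨⟨fun N hpN hLN hN => ?_, fun N hN => ?_, fun N hN => ?_, ?_, fun N hLN hN => ?_⟩, ?_⟩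
  · by_contra hneg
    exact hg N hN (Or.inl (Or.inl (Or.inl ⟨hpN, hLN, hneg⟩)))
  · refine (hx N hN).trans ?_
    gcongr
    linarith
  · have h1 : ω ∉ B₃ N := fun h1 => hg N hN (Or.inl (Or.inr h1))
    simp only [B₃, Set.mem_ofPred_eq, not_le, one_mul, Finset.sum_const, Nat.card_Icc,
      nsmul_eq_mul, mul_one, Nat.add_sub_cancel, Real.norm_eq_abs, sq_abs] at h1
    have h2 : 0 ≤ A₂ * (N : ℝ) := by positivity
    have h3 : 6 * A₂ * (N + L) ≤ A * (N + L) := by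
      gcongr
      linarith
    nlinarith
  · simp only [B₄, Set.mem_ofPred_eq, not_le] at hg₄
    refine hg₄.le.trans ?_
    calc A₁ * (∑ t ∈ Finset.Icc 1 n, 1 / (t : ℝ) + 6 * L) ≤ A₁ * (2 * L + 6 * L) := by
          gcongr
          exact sum_one_div_le hL
      _ = 8 * A₁ * L := by ring
      _ ≤ A * L := by gcongr; linarith
  · have hN0 : (0 : ℝ) < N := by linarith
    have hl : 0 < l N := Real.sqrt_pos.2 (by positivity)
    have hNl : N * l N = √(N * L) := by
      rw [show (N : ℝ) * L = N ^ 2 * (L / N) by field_simp, Real.sqrt_mul (by positivity),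
        Real.sqrt_sq hN0.le]
    have hLl : L / l N = √(N * L) := by
      rw [div_eq_iff hl.ne', ← Real.sqrt_mul (by positivity),
        show (N : ℝ) * L * (L / N) = L ^ 2 by field_simp, Real.sqrt_sq (by linarith)]
    have h1 : ‖∑ t ∈ Finset.Icc 1 N, ε t ω • x t ω‖ ≤
        p * ((6 * σ ^ 2 * A₁ + 6) * √(N * L)) := by
      refine norm_sum_le_of_inner_lt fun j s hs => ?_
      have h2 : ω ∉ B₅ N j s := fun h2 => hg N hN (Or.inr (by
        simp only [Set.mem_iUnion]
        exact ⟨(j, s), Finset.mem_product.2 ⟨Finset.mem_univ j, hs⟩, h2⟩))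
      simp only [B₅, Set.mem_ofPred_eq, not_and, not_le] at h2
      have h3 : ∑ t ∈ Finset.Icc 1 N, ⟪x t ω, s • EuclideanSpace.single j (1 : ℝ)⟫ ^ 2 ≤
          12 * A₁ * N := by
        calc _ ≤ ∑ t ∈ Finset.Icc 1 N, ‖x t ω‖ ^ 2 := by
              refine Finset.sum_le_sum fun t _ => ?_
              have hs2 : s ^ 2 = 1 := by
                simp only [Finset.mem_insert, Finset.mem_singleton] at hs
                rcases hs with rfl | rfl <;> norm_num
              rw [real_inner_smul_right, mul_pow, hs2, one_mul, ← sq_abs]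
              gcongr
              refine (abs_real_inner_le_norm _ _).trans ?_
              simp
          _ ≤ 6 * A₁ * (N + L) := hx N hN
          _ ≤ 6 * A₁ * (N + N) := by gcongr
          _ = _ := by ring
      refine (h2 hl).le.trans ?_
      calc _ ≤ l N * σ ^ 2 / 2 * (12 * A₁ * N) + 6 * L / l N := by gcongr
        _ = 6 * σ ^ 2 * A₁ * (N * l N) + 6 * (L / l N) := by ring
        _ = _ := by rw [hNl, hLl]; ring
    refine h1.trans ?_
    rw [← mul_assoc]
    gcongr
    linarith
  · simp only [B₆, Set.mem_ofPred_eq, not_le] at hg₆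
    refine hg₆.le.trans ?_
    have h1 : 1 / σ ^ 2 * σ ^ 2 / 2 = (1 : ℝ) / 2 := by field_simp
    have h2 : 6 * L / (1 / σ ^ 2) = 6 * σ ^ 2 * L := by field_simp
    rw [h1, h2]
    gcongr
    linarith

end HighProbability

/-! ### Positive definiteness, measurability and the ridge phase. -/

section Main

variable {p : ℕ}

lemma spectrum_finite (A : Matrix (Fin p) (Fin p) ℝ) : (spectrum ℝ A).Finite := by
  rw [← Matrix.spectrum_toLin']
  exact Module.End.finite_spectrum _

lemma posDef_of_lamMin_sqrt_pos {Sig : Matrix (Fin p) (Fin p) ℝ} (hSig : Sig.PosSemidef)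
    (h : 0 < lamMin (CFC.sqrt Sig)) : Sig.PosDef := by
  have hunit : IsUnit (CFC.sqrt Sig) := by
    rw [← spectrum.zero_notMem_iff ℝ]
    intro h0
    have := csInf_le (spectrum_finite (CFC.sqrt Sig)).bddBelow h0
    exact absurd h (not_lt.2 this)
  rw [hSig.posDef_iff_isUnit, ← CFC.sqrt_mul_sqrt_self Sig hSig.nonneg]
  exact hunit.mul hunit

/-- The condition on λ places a nonnegative number strictly below 0.9 λ_min(√Σ) minus a square root,
so λ_min(√Σ) > 0. -/
lemma BetaMin.posDef {Sig : Matrix (Fin p) (Fin p) ℝ} (hSig : Sig.PosSemidef) {σ : ℝ}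
    {β : Vec (Fin p)} {n : ℕ} (h : BetaMin Sig σ β n) : Sig.PosDef := by
  obtain ⟨lam, _, h1, _⟩ := h
  refine posDef_of_lamMin_sqrt_pos hSig ?_
  have := Real.sqrt_nonneg lam
  have := Real.sqrt_nonneg ((p : ℝ) / nZero p n)
  linarith

lemma IsOnline.measurable_past {Ω : Type*} [MeasurableSpace Ω] {x : ℕ → Ω → Vec (Fin p)}
    {ε : ℕ → Ω → ℝ} {β : Vec (Fin p)} {b : ℕ → Ω → Vec (Fin p)} {n : ℕ}
    (h : IsOnline x (response x ε β) b n) {i : ℕ} (hi : 1 ≤ i) (hin : i ≤ n) :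
    Measurable[past x ε i] (b i) := by
  refine (h i hi hin).mono (iSup₂_le fun t ht => ?_) le_rfl
  rw [Finset.mem_Ico] at ht
  have hm := OLSth.measurable_past (x := x) (ε := ε) ht.1 ht.2
  exact (hm.1.prodMk ((hm.1.inner (𝕜 := ℝ) measurable_const).add hm.2)).comap_le

/-- As n₀ ≥ p + 1 and n₀ ≥ 400 log n ≥ log n + 1, every step with i - 1 < p or i - 1 < log n is
still a ridge step. -/
lemma IsOLSthRun.exists_isLSthFit {x : ℕ → Vec (Fin p)} {y : ℕ → ℝ} {r : ℝ} {k n : ℕ}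
    {b : ℕ → Vec (Fin p)} (h : IsOLSthRun x y r k n b) (hr : 0 ≤ r) (hn : 1 ≤ Real.log n) {i : ℕ}
    (hi : 1 ≤ i) (hin : i ≤ n) :
    ∃ r', 0 ≤ r' ∧ r' ≤ r ∧ (i - 1 < p ∨ ((i - 1 : ℕ) : ℝ) < Real.log n → r' = r) ∧
      IsLSthFit x y r' k i (b i) := by
  by_cases hc : (i : ℝ) ≤ nZero p n
  · exact ⟨r, hr, le_rfl, fun _ => rfl, (h i hi hin).1 hc⟩
  · refine ⟨0, le_rfl, hr, fun hcase => absurd ?_ hc, (h i hi hin).2 (not_le.1 hc)⟩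
    rw [Nat.cast_sub hi, Nat.cast_one] at hcase
    rcases hcase with h1 | h1
    · have : (i : ℝ) ≤ (p : ℝ) + 1 := by exact_mod_cast (by omega : i ≤ p + 1)
      exact this.trans (le_max_left _ _)
    · refine le_trans ?_ ((le_max_left _ _).trans (le_max_right _ _))
      linarith

end Main

end OLSth

theorem theorem10 {p : ℕ} (hp : 2 ≤ p) (Sig : Matrix (Fin p) (Fin p) ℝ) (hSig : Sig.PosSemidef)
    (σ : ℝ) (hσ : 0 < σ) (r : ℝ) (hr : 0 < r) (B : ℝ) :
    ∃ C₁ : ℝ, 0 < C₁ ∧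
      ∀ (Ω : Type*) [MeasurableSpace Ω] (P : Measure Ω) [IsProbabilityMeasure P]
        (x : ℕ → Ω → EuclideanSpace ℝ (Fin p)) (ε : ℕ → Ω → ℝ),
        OLSth.IsGaussianStream P Sig σ x ε →
      ∀ (βs : EuclideanSpace ℝ (Fin p)), ‖βs‖ ≤ B →
      ∀ (n : ℕ), p < n → OLSth.BetaMin Sig σ βs n →
      ∀ (b : ℕ → Ω → EuclideanSpace ℝ (Fin p)),
        OLSth.IsOnline x (OLSth.response x ε βs) b n →
        (∀ ω, OLSth.IsOLSthRun (fun i => x i ω) (fun i => OLSth.response x ε βs i ω) r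
          (OLSth.supp βs).card n (fun i => b i ω)) →
      ∀ (m M D G : ℝ),
        P {ω | ¬ (OLSth.EigBounds (fun i => OLSth.restrictTo (OLSth.supp βs) (x i ω)) p n m M →
            OLSth.IterateBounds (fun i => OLSth.restrictTo (OLSth.supp βs) (x i ω))
              (fun i => OLSth.response x ε βs i ω) p n D G →
            OLSth.regret (fun i => x i ω) (fun i => OLSth.response x ε βs i ω)
                (OLSth.supp βs).card n (fun i => b i ω) ≤
              C₁ * (1 + G ^ 2 / m + M * D ^ 2) * (Real.log n ^ 2 / n))}
          ≤ ENNReal.ofReal (3 / n) := by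
  by_cases hpd : Sig.PosDef
  swap
  -- For singular Σ the condition on λ cannot hold, so any constant will do.
  · exact ⟨1, one_pos, fun _ _ _ _ _ _ _ _ _ _ _ hβ => absurd (hβ.posDef hSig) hpd⟩
  obtain ⟨c, A, hc, hA, hprob⟩ := OLSth.exists_measure_not_isRegular_le (by omega) hpd hσ
  obtain ⟨C, hC, hreg⟩ := OLSth.exists_regret_le p (by omega) (B := B) hc hA hr
  refine ⟨C, hC, fun Ω _ P _ x ε hstream βs hβs n hpn _ b hon hrun m M D G => ?_⟩
  refine (measure_mono fun ω hω => ?_).trans (hprob Ω P x ε hstream n hpn (by omega)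
    (fun i ω => βs - b i ω)
    fun i h1 h2 => measurable_const.sub (hon.measurable_past h1 h2))
  simp only [Set.mem_ofPred_eq] at hω ⊢
  intro hgood
  refine hω fun heig _ => ?_
  have hn : (3 : ℝ) ≤ n := by exact_mod_cast (by omega : 3 ≤ n)
  have hL : 1 ≤ Real.log n := by
    rw [Real.le_log_iff_exp_le (by linarith)]
    linarith [Real.exp_one_lt_three]
  have hLn : Real.log n ≤ n := Real.log_le_self (by linarith)
  have hmain := hreg (fun i => x i ω) (fun i => ε i ω) n (Real.log n) hgood.1 hpn.le hL hLn βs hβs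
    (fun i => b i ω) (fun i h1 h2 => (hrun ω).exists_isLSthFit hr.le hL h1 h2) hgood.2
  refine hmain.trans ?_
  have hm : 0 < m := heig.1
  have hM : 0 < M := hm.trans heig.2.1
  -- Positivity of m and M makes the factor at least 1, so the bound C log² n / n suffices.
  have h1 : C ≤ C * (1 + G ^ 2 / m + M * D ^ 2) := by
    refine le_mul_of_one_le_right hC.le ?_
    have : 0 ≤ G ^ 2 / m := by positivity
    have : 0 ≤ M * D ^ 2 := by positivity
    linarith
  gcongr
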